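/- Let $(X_p)_{p\text{ prime}}$ be independent random variables uniformly distributed on the unit circle, and let $X_{-1}$ be independent of them with $X_{-1}=\pm1$ with probability $1/2$ each. Put $X_n=\prod_{p^a\| n}X_p^a$ and $X_{-n}=X_{-1}X_n$ for $n\ge 1$ (a Steinhaus random multiplicative function). Write $e(x)=e^{2\pi i x}$, let $P^+(n)$ be the largest prime factor of $n$ ($P^+(1)=1$), and for $y>1$, $t\in[0,1]$ let $$S_y(t)=\sum_{\substack{n\ne 0\\ P^+(|n|)\le y}}\frac{1-e(nt)}{n}X_n,\qquad R_y(t)=\sum_{\substack{n\ne 0\\ P^+(|n|)>y}}\frac{1-e(nt)}{n}X_n,$$ where $n$ runs over integers and the second series is understood as $\lim_{z\to\infty}$ of the (absolutely convergent) sums over $y<P^+(|n|)\le z$; almost surely, for every $y>1$, this limit exists uniformly in $t\in[0,1]$. Let $\|R_y\|_\infty=\max_{t\in[0,1]}|R_y(t)|$. Then there is an absolute constant $y_0>1$ such that for all $\epsilon>0$ and all real $y\ge y_0$, $$\mathbf{P}\big(\|R_y\|_\infty>\epsilon\big)\ll \exp\left\{\frac{-\epsilon^2y^{1/3}}{\log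 y\,(\log y+O(1))}\left(\log\Big(\frac{(\log y)^{20}}{\log y+O(1)}\Big)+O(\log\epsilon)\right)\right\},$$ where the implied constants are absolute, the quantities $O(1)$, $O(\log\epsilon)$ depend only on $\epsilon$ and $y$, and both expressions $\log y+O(1)$ are positive. The bound holds independently of $S_y$: with $\mathcal B(\epsilon,y)$ denoting the resulting upper bound (implied constant included), $\mathbf P(\{\|R_y\|_\infty>\epsilon\}\cap A)\le \mathcal B(\epsilon,y)\,\mathbf P(A)$ for every event $A$ in the $\sigma$-algebra generated by $(S_y(t))_{t\in[0,1]}$. In particular, for every fixed $\epsilon>0$, $\mathbf P(\|R_y\|_\infty>\epsilon)\to0$ as $y\to\infty$. -/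

import Mathlib

open MeasureTheory ProbabilityTheory Filter Topology

noncomputable section

namespace RoughPart

/-- `e(x) = exp(2πix)`. -/
def e (x : ℝ) : ℂ := Complex.exp (2 * Real.pi * Complex.I * x)

/-- `P⁺(n)`, the largest prime factor of `n`, with `P⁺(1) = 1`. -/
def largestPrimeFactor (n : ℕ) : ℕ := max 1 (n.primeFactors.sup id)

/-- The uniform distribution on the unit circle `{|z| = 1}`: the law of `e(θ)` for `θ` uniform on
`[0,1]`. -/
def uniformCircle : Measure ℂ := (volume.restrict (Set.Icc (0 : ℝ) 1)).map e

/-- `X` is a Steinhaus random multiplicative function on the nonzero integers (the value `X 0` plays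
no role): the `X_p` (`p` prime) are uniform on the unit circle, `X_{-1} = ±1` with probability `1/2`
each, these variables are all independent, `X_n = ∏_{p^a ∥ n} X_p^a` and `X_{-n} = X_{-1} X_n` for
`n ≥ 1`. -/
structure IsSteinhausRMF {Ω : Type*} [MeasurableSpace Ω] (X : ℤ → Ω → ℂ) (μ : Measure Ω) :
    Prop where
  measurable_prime : ∀ p : Nat.Primes, Measurable (X ((p : ℕ) : ℤ))
  measurable_neg_one : Measurable (X (-1))
  law_prime : ∀ p : Nat.Primes, μ.map (X ((p : ℕ) : ℤ)) = uniformCircle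
  law_neg_one : μ.map (X (-1)) =
    (1 / 2 : ENNReal) • (Measure.dirac (1 : ℂ) + Measure.dirac (-1 : ℂ))
  indep : iIndepFun
    (fun i : Option Nat.Primes => i.elim (X (-1)) (fun p => X ((p : ℕ) : ℤ))) μ
  apply_pos : ∀ n : ℕ, 0 < n → ∀ ω,
    X (n : ℤ) ω = ∏ p ∈ n.primeFactors, X (p : ℤ) ω ^ n.factorization p
  apply_neg : ∀ n : ℕ, 0 < n → ∀ ω, X (-(n : ℤ)) ω = X (-1) ω * X (n : ℤ) ω

variable {Ω : Type*}

/-- The `y`-smooth part `S_y(t) = ∑_{n ≠ 0, P⁺(|n|) ≤ y} (1 - e(nt)) X_n / n`, an absolutely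
convergent series. -/
def smoothPart (X : ℤ → Ω → ℂ) (y : ℝ) (ω : Ω) (t : ℝ) : ℂ :=
  ∑' n : {n : ℤ // n ≠ 0 ∧ (largestPrimeFactor n.natAbs : ℝ) ≤ y},
    (1 - e ((n : ℤ) * t)) / ((n : ℤ) : ℂ) * X n ω

/-- The absolutely convergent series
`∑_{n ≠ 0, y < P⁺(|n|) ≤ z} (1 - e(nt)) X_n / n`. -/
def truncatedRoughPart (X : ℤ → Ω → ℂ) (y z : ℝ) (ω : Ω) (t : ℝ) : ℂ :=
  ∑' n : {n : ℤ // n ≠ 0 ∧ y < (largestPrimeFactor n.natAbs : ℝ) ∧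
      (largestPrimeFactor n.natAbs : ℝ) ≤ z},
    (1 - e ((n : ℤ) * t)) / ((n : ℤ) : ℂ) * X n ω

/-- The `y`-rough part `R_y(t) = ∑_{n ≠ 0, P⁺(|n|) > y} (1 - e(nt)) X_n / n`. The series is not
absolutely convergent; it is summed over smooth numbers, that is, as the limit for `z → ∞` of the
sums over `y < P⁺(|n|) ≤ z`. -/
def roughPart (X : ℤ → Ω → ℂ) (y : ℝ) (ω : Ω) (t : ℝ) : ℂ :=
  limUnder atTop (fun z : ℝ => truncatedRoughPart X y z ω t)

/-- `‖f‖_∞` on `[0,1]`, with value `∞` if `f` is unbounded there. -/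
def supNorm (f : ℝ → ℂ) : ENNReal := ⨆ t ∈ Set.Icc (0 : ℝ) 1, ‖f t‖ₑ

/-- The event `‖R_y‖_∞ > ε`. -/
def roughEvent (X : ℤ → Ω → ℂ) (y ε : ℝ) : Set Ω :=
  {ω | ENNReal.ofReal ε < supNorm (roughPart X y ω)}

/-- The σ-algebra generated by the random function `S_y` on `[0,1]`. -/
@[reducible] def smoothSigma (X : ℤ → Ω → ℂ) (y : ℝ) : MeasurableSpace Ω :=
  MeasurableSpace.comap (fun ω (t : Set.Icc (0 : ℝ) 1) => smoothPart X y ω t) MeasurableSpace.pi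

end RoughPart

end

/-!
Write `Z_{N,k}(t)` for the sum of `(1 - e(nt)) X_n / n` over the nonzero integers `n` with `N <
P⁺(|n|) ≤ k`, so that `R_y` is the limit of `Z_{⌊y⌋,k}` as `k → ∞`. The sums `Z_{N,k}(t)` form a
martingale in `k`: an integer with largest prime factor `p` carries a factor `X_p ^ a` with `a ≥
1`, which has mean zero and is independent of `X_{-1}` and of the `X_q` with `q < p`
(`IsSteinhausRMF.integral_mul_blockSum_pred`). The difference at `p` is at most `4 L(p) / p`,
where `L(p)` is the sum of the reciprocals of the `p`-smooth integers, and `L(p) ≪ p^{1/10}` by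
Chebyshev's bound (`smoothSum_one_le`). Azuma's inequality then shows that, for fixed `t` and `k ≤
2N`, `|Z_{N,k}(t)| > N^{-1/10}` has probability `O(exp(-c N^{3/5}))`, conditionally on the primes
up to `N` (`IsSteinhausRMF.measure_lt_norm_randomBlock_le`).

To pass to the supremum over `t`, observe that `Z_{N,k}` with `k ≤ 2N` is Hölder continuous with
exponent `1 / (3 log (2N))` and a constant polynomial in `N` (`norm_blockSum_sub_le`), so a grid
with `exp(3 log² (2N))` points suffices, far fewer than the tail bound can absorb. Hence the range
`(N, 2N]` contributes more than `2 N^{-1/10}` with probability at most `exp(-√N)`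
(`exists_measure_badEvent_le`). Summing over the ranges `(2^j N, 2^{j+1} N]` gives both the almost
sure uniform convergence and a bound `O(exp(-√⌊y⌋))` for the probability that `‖R_y‖_∞` exceeds a
multiple of `⌊y⌋^{-1/10}`, conditionally on `S_y` (`exists_measure_roughEvent_le`).

This is stronger than required. With both `O(1)` terms equal to `0` and the `O(log ε)` term equal
to `-19 |log ε|`, the required bound is at least `1` unless `1 / log y ≤ ε ≤ log y`, and in that
range it is at least `exp(-19 y^{1/3} log log y)`, which dominates `exp(-√⌊y⌋)`.

The `X_p` are unimodular only almost surely. The argument is carried out for the modification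
`unitRMF X`, which is unimodular everywhere, so that all sums over smooth integers converge
absolutely and are measurable.
-/

namespace RoughPart

/-! ### Sums over smooth integers -/

/-- The Euler product `∏_{p ≤ k} (1 - p^{-σ})⁻¹`, which is the sum of `n^{-σ}` over the positive
`k`-smooth integers `n`. -/
noncomputable def smoothSum (σ : ℝ) (k : ℕ) : ℝ :=
  ∏ p ∈ Nat.primesBelow (k + 1), (1 - (p : ℝ) ^ (-σ))⁻¹

lemma rpow_neg_lt_one {σ : ℝ} (hσ : 0 < σ) {p : ℕ} (hp : p.Prime) : (p : ℝ) ^ (-σ) < 1 :=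
  Real.rpow_lt_one_of_one_lt_of_neg (by exact_mod_cast hp.one_lt) (by linarith)

lemma smoothSum_nonneg {σ : ℝ} (hσ : 0 < σ) (k : ℕ) : 0 ≤ smoothSum σ k :=
  Finset.prod_nonneg fun p hp => by
    have := rpow_neg_lt_one hσ (Nat.prime_of_mem_primesBelow hp)
    rw [inv_nonneg]; linarith

lemma one_le_inv_one_sub_rpow {σ : ℝ} (hσ : 0 < σ) {p : ℕ} (hp : p.Prime) :
    1 ≤ (1 - (p : ℝ) ^ (-σ))⁻¹ := by
  have h1 := rpow_neg_lt_one hσ hp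
  have h2 : 0 ≤ (p : ℝ) ^ (-σ) := by positivity
  exact (one_le_inv₀ (by linarith)).2 (by linarith)

/-- `n ↦ n^{-σ}` as a completely multiplicative function. -/
noncomputable def rpowNegHom (σ : ℝ) : ℕ →* ℝ where
  toFun n := (n : ℝ) ^ (-σ)
  map_one' := by simp
  map_mul' a b := by
    push_cast
    exact Real.mul_rpow (by positivity) (by positivity)

lemma hasSum_smoothNumbers {σ : ℝ} (hσ : 0 < σ) (k : ℕ) :
    HasSum ((Nat.smoothNumbers (k + 1)).indicator fun m : ℕ => (m : ℝ) ^ (-σ))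
      (smoothSum σ k) := by
  have h := (EulerProduct.summable_and_hasSum_smoothNumbers_prod_primesBelow_geometric
    (f := rpowNegHom σ) (fun {p} hp => by
      have := rpow_neg_lt_one hσ hp
      simp only [rpowNegHom, MonoidHom.coe_mk, OneHom.coe_mk]
      rwa [Real.norm_of_nonneg (by positivity)]) (k + 1)).2
  exact hasSum_subtype_iff_indicator.1 h

lemma one_le_largestPrimeFactor (n : ℕ) : 1 ≤ largestPrimeFactor n := le_max_left _ _

lemma largestPrimeFactor_le_iff {n k : ℕ} (hk : 1 ≤ k) :
    largestPrimeFactor n ≤ k ↔ ∀ p ∈ n.primeFactors, p ≤ k := by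
  simp [largestPrimeFactor, hk]

lemma largestPrimeFactor_mem {n : ℕ} (h : 1 < largestPrimeFactor n) :
    largestPrimeFactor n ∈ n.primeFactors := by
  have h2 : largestPrimeFactor n = n.primeFactors.sup id := by
    unfold largestPrimeFactor at h ⊢
    omega
  have hne : n.primeFactors.Nonempty := by
    by_contra hne
    rw [Finset.not_nonempty_iff_eq_empty] at hne
    simp [h2, hne] at h
  obtain ⟨p, hp, hpe⟩ := Finset.exists_mem_eq_sup _ hne id
  rw [h2, hpe]
  exact hp

/-- The nonzero integers `n` with `N < P⁺(|n|) ≤ k`. -/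
def block (N k : ℕ) : Set ℤ :=
  {n | n ≠ 0 ∧ N < largestPrimeFactor n.natAbs ∧ largestPrimeFactor n.natAbs ≤ k}

lemma natAbs_mem_smoothNumbers {N k : ℕ} {n : ℤ} (h : n ∈ block N k) :
    n.natAbs ∈ Nat.smoothNumbers (k + 1) := by
  obtain ⟨h0, -, h2⟩ := h
  have hk : 1 ≤ k := (one_le_largestPrimeFactor _).trans h2
  rw [Nat.mem_smoothNumbers]
  refine ⟨by simpa using h0, fun p hp => ?_⟩
  have := (largestPrimeFactor_le_iff hk).1 h2 p
    (Nat.mem_primeFactors_iff_mem_primeFactorsList.2 hp)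
  omega

lemma hasSum_natAbs {f : ℕ → ℝ} {a : ℝ} (h0 : f 0 = 0) (h : HasSum f a) :
    HasSum (fun n : ℤ => f n.natAbs) (2 * a) := by
  have := HasSum.of_nat_of_neg (f := fun n : ℤ => f n.natAbs)
    (by simpa only [Int.natAbs_natCast] using h)
    (by simpa only [Int.natAbs_neg, Int.natAbs_natCast] using h)
  rwa [Int.natAbs_zero, h0, sub_zero, ← two_mul] at this

lemma indicator_block_le {σ : ℝ} (N k : ℕ) (n : ℤ) :
    (block N k).indicator (fun n : ℤ => (n.natAbs : ℝ) ^ (-σ)) n ≤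
      (Nat.smoothNumbers (k + 1)).indicator (fun m : ℕ => (m : ℝ) ^ (-σ)) n.natAbs := by
  by_cases h : n ∈ block N k
  · rw [Set.indicator_of_mem h, Set.indicator_of_mem (natAbs_mem_smoothNumbers h)]
  · rw [Set.indicator_of_notMem h]
    exact Set.indicator_nonneg (fun _ _ => by positivity) _

lemma hasSum_smoothNumbers_natAbs {σ : ℝ} (hσ : 0 < σ) (k : ℕ) :
    HasSum (fun n : ℤ => (Nat.smoothNumbers (k + 1)).indicator
      (fun m : ℕ => (m : ℝ) ^ (-σ)) n.natAbs) (2 * smoothSum σ k) :=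
  hasSum_natAbs (Set.indicator_of_notMem (fun h => h.1 rfl) _) (hasSum_smoothNumbers hσ k)

lemma summable_block {σ : ℝ} (hσ : 0 < σ) (N k : ℕ) :
    Summable ((block N k).indicator fun n : ℤ => (n.natAbs : ℝ) ^ (-σ)) :=
  Summable.of_nonneg_of_le (fun _ => Set.indicator_nonneg (fun _ _ => by positivity) _)
    (indicator_block_le N k) (hasSum_smoothNumbers_natAbs hσ k).summable

lemma tsum_block_le {σ : ℝ} (hσ : 0 < σ) (N k : ℕ) :
    ∑' n : ℤ, (block N k).indicator (fun n : ℤ => (n.natAbs : ℝ) ^ (-σ)) n ≤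
      2 * smoothSum σ k :=
  (Summable.tsum_le_tsum (indicator_block_le N k) (summable_block hσ N k)
    (hasSum_smoothNumbers_natAbs hσ k).summable).trans_eq (hasSum_smoothNumbers_natAbs hσ k).tsum_eq

lemma largestPrimeFactor_mono {m n : ℕ} (h : m ∣ n) (hn : n ≠ 0) :
    largestPrimeFactor m ≤ largestPrimeFactor n :=
  max_le_max le_rfl (Finset.sup_mono (Nat.primeFactors_mono h hn))

lemma mem_block_pred {p : ℕ} (hp : 1 < p) {n : ℤ} :
    n ∈ block (p - 1) p ↔ n ≠ 0 ∧ largestPrimeFactor n.natAbs = p := by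
  refine and_congr_right fun _ => ?_
  omega

lemma prime_dvd_of_mem_block {p : ℕ} (hp : 1 < p) {n : ℤ} (h : n ∈ block (p - 1) p) :
    p.Prime ∧ p ∣ n.natAbs := by
  rw [mem_block_pred hp] at h
  have := largestPrimeFactor_mem (n := n.natAbs) (by omega)
  rw [h.2, Nat.mem_primeFactors] at this
  exact ⟨this.1, this.2.1⟩

/-- The integers with largest prime factor `p` are multiples `p m` of `p`-smooth integers `m`, which
gains a factor `1 / p` over `tsum_block_le`. -/
lemma tsum_block_pred_le {p : ℕ} (hp : 1 < p) :
    ∑' n : ℤ, (block (p - 1) p).indicator (fun n : ℤ => (n.natAbs : ℝ) ^ (-1 : ℝ)) n ≤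
      2 * smoothSum 1 p / p := by
  have hinj : Function.Injective fun m : ℤ => (p : ℤ) * m :=
    mul_right_injective₀ (by positivity)
  rw [← hinj.tsum_eq]
  · have hs := summable_block (σ := 1) one_pos 0 p
    have hle : ∀ m : ℤ, (block (p - 1) p).indicator (fun n : ℤ => (n.natAbs : ℝ) ^ (-1 : ℝ))
        ((p : ℤ) * m) ≤ (p : ℝ)⁻¹ *
          (block 0 p).indicator (fun n : ℤ => (n.natAbs : ℝ) ^ (-1 : ℝ)) m := by
      intro m
      by_cases h : (p : ℤ) * m ∈ block (p - 1) p
      · have hm : m ∈ block 0 p := by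
          have h' := (mem_block_pred hp).1 h
          refine ⟨fun h0 => h'.1 (by simp [h0]), one_le_largestPrimeFactor _, ?_⟩
          rw [← h'.2]
          refine largestPrimeFactor_mono ?_ (by simpa using h'.1)
          rw [Int.natAbs_mul]
          exact dvd_mul_left _ _
        rw [Set.indicator_of_mem h, Set.indicator_of_mem hm, Int.natAbs_mul, Int.natAbs_natCast,
          Nat.cast_mul, Real.mul_rpow (by positivity) (by positivity), Real.rpow_neg_one (p : ℝ)]
      · rw [Set.indicator_of_notMem h]
        exact mul_nonneg (by positivity) (Set.indicator_nonneg (fun _ _ => by positivity) _)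
    calc _ ≤ ∑' m : ℤ, (p : ℝ)⁻¹ *
          (block 0 p).indicator (fun n : ℤ => (n.natAbs : ℝ) ^ (-1 : ℝ)) m :=
          Summable.tsum_le_tsum hle ((summable_block one_pos _ _).comp_injective hinj)
            (hs.mul_left _)
      _ ≤ (p : ℝ)⁻¹ * (2 * smoothSum 1 p) := by
          rw [tsum_mul_left]
          exact mul_le_mul_of_nonneg_left (tsum_block_le one_pos 0 p) (by positivity)
      _ = _ := by ring
  · intro n hn
    have hn' : n ∈ block (p - 1) p := by
      by_contra h
      exact hn (Set.indicator_of_notMem h _)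
    obtain ⟨-, h⟩ := prime_dvd_of_mem_block hp hn'
    obtain ⟨m, hm⟩ := Int.natCast_dvd.2 h
    exact ⟨m, hm.symm⟩

/-- For `σ` close enough to `1`, the Euler product at `σ` is at most the square of that at `1`. -/
lemma smoothSum_le_sq {k : ℕ} (hk : 2 ≤ k) :
    smoothSum (1 - 1 / (3 * Real.log k)) k ≤ smoothSum 1 k ^ 2 := by
  have hlog : 0 < Real.log k := Real.log_pos (by exact_mod_cast hk)
  unfold smoothSum
  rw [← Finset.prod_pow]
  have key : ∀ p ∈ Nat.primesBelow (k + 1),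
      (1 - (p : ℝ) ^ (-(1:ℝ))) ^ 2 ≤ 1 - (p : ℝ) ^ (-(1 - 1 / (3 * Real.log k))) := by
    intro p hp
    have hpp := Nat.prime_of_mem_primesBelow hp
    have hpk : (p : ℝ) ≤ k := by exact_mod_cast Nat.lt_succ_iff.1 (Nat.lt_of_mem_primesBelow hp)
    have hp2 : (2 : ℝ) ≤ p := by exact_mod_cast hpp.two_le
    have hp0 : (0 : ℝ) < p := by linarith
    have h1 : (p : ℝ) ^ (1 / (3 * Real.log k)) ≤ 3 / 2 := by
      rw [Real.rpow_def_of_pos hp0]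
      have : Real.log p * (1 / (3 * Real.log k)) ≤ 1 / 3 := by
        rw [mul_one_div, div_le_iff₀ (by positivity)]
        have := Real.log_le_log hp0 hpk
        linarith
      refine (Real.exp_le_exp.2 this).trans ?_
      -- `e < (3/2)³`
      have h3 : Real.exp (1 / 3) ^ 3 ≤ (3 / 2) ^ 3 := by
        rw [← Real.exp_nat_mul]
        norm_num
        linarith [Real.exp_one_lt_d9]
      exact le_of_pow_le_pow_left₀ (by norm_num) (by norm_num) h3
    have h2 : (p : ℝ) ^ (-(1 - 1 / (3 * Real.log k))) ≤ 3 / 2 * (p : ℝ)⁻¹ := by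
      rw [neg_sub, sub_eq_add_neg, Real.rpow_add hp0, Real.rpow_neg_one]
      gcongr
    rw [Real.rpow_neg_one]
    have h3 : (p : ℝ)⁻¹ ≤ 1 / 2 := by
      rw [inv_le_comm₀ hp0 (by norm_num)]; linarith
    have h4 : 0 < (p : ℝ)⁻¹ := by positivity
    nlinarith
  refine Finset.prod_le_prod (fun p hp => ?_) (fun p hp => ?_)
  · have := key p hp
    exact inv_nonneg.2 ((sq_nonneg _).trans this)
  · have hpp := Nat.prime_of_mem_primesBelow hp
    have := rpow_neg_lt_one one_pos hpp
    rw [inv_pow]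
    exact inv_anti₀ (by have : 0 < 1 - (p : ℝ) ^ (-(1:ℝ)) := by linarith
                        positivity) (key p hp)

/-- As primes have density zero, the primes in `(n/2, n]` contribute little for large `n`, and the
bound follows by repeatedly halving `n`. -/
lemma sum_primesBelow_le : ∃ C : ℝ, ∀ n : ℕ, 1 ≤ n →
    ∑ p ∈ Nat.primesBelow n, 1 / ((p : ℝ) - 1) ≤ C + 1 / 10 * Real.log n := by
  obtain ⟨n₀, hn₀⟩ : ∃ n₀ : ℕ, ∀ n : ℕ, n₀ ≤ n → (Nat.primeCounting n : ℝ) ≤ n / 100 := by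
    have h := (Chebyshev.eventually_primeCounting_le one_pos).and
      ((Real.tendsto_log_atTop.eventually_ge_atTop (100 * (Real.log 4 + 1))).and
        (eventually_gt_atTop 1))
    obtain ⟨n₀, hn₀⟩ := eventually_atTop.1 (tendsto_natCast_atTop_atTop.eventually h)
    refine ⟨n₀, fun n hn => ?_⟩
    obtain ⟨h1, h2, h3⟩ := hn₀ n hn
    rw [Nat.floor_natCast] at h1
    refine h1.trans ?_
    rw [div_le_iff₀ (Real.log_pos h3)]
    nlinarith
  set M := max n₀ 10 with hM
  refine ⟨∑ p ∈ Nat.primesBelow M, 1 / ((p : ℝ) - 1), fun n => ?_⟩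
  have hnn : ∀ n, ∀ p ∈ Nat.primesBelow n, 0 ≤ 1 / ((p : ℝ) - 1) := by
    intro n p hp
    have : (2 : ℝ) ≤ p := by exact_mod_cast (Nat.prime_of_mem_primesBelow hp).two_le
    exact one_div_nonneg.2 (by linarith)
  induction n using Nat.strong_induction_on with
  | _ n ih =>
  intro h1
  rcases le_or_gt n M with h | h
  · have : ∑ p ∈ Nat.primesBelow n, 1 / ((p : ℝ) - 1) ≤
        ∑ p ∈ Nat.primesBelow M, 1 / ((p : ℝ) - 1) := by
      refine Finset.sum_le_sum_of_subset_of_nonneg (fun p hp => ?_) fun p hp _ => hnn _ p hp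
      rw [Nat.mem_primesBelow] at hp ⊢
      exact ⟨by omega, hp.2⟩
    have := Real.log_nonneg (x := n) (by exact_mod_cast h1)
    linarith
  · have hn10 : 10 ≤ n := by omega
    have hnn0 : n₀ ≤ n := by omega
    have ih' := ih (n / 2 + 1) (by omega) (by omega)
    set S := (Nat.primesBelow n).filter (fun p => n / 2 + 1 ≤ p)
    have hsplit : ∑ p ∈ Nat.primesBelow n, 1 / ((p : ℝ) - 1) ≤
        ∑ p ∈ Nat.primesBelow (n / 2 + 1), 1 / ((p : ℝ) - 1) + ∑ p ∈ S, 1 / ((p : ℝ) - 1) := by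
      rw [← Finset.sum_filter_add_sum_filter_not (Nat.primesBelow n) (fun p => n / 2 + 1 ≤ p),
        add_comm]
      refine add_le_add_left (Finset.sum_le_sum_of_subset_of_nonneg (fun p hp => ?_)
        fun p hp _ => hnn _ p hp) _
      rw [Finset.mem_filter, Nat.mem_primesBelow] at hp
      rw [Nat.mem_primesBelow]
      exact ⟨by omega, hp.1.2⟩
    have hcard : (S.card : ℝ) ≤ n / 100 := by
      refine le_trans ?_ (hn₀ n hnn0)
      rw [Nat.primeCounting, Nat.primeCounting', Nat.count_eq_card_filter_range]
      exact_mod_cast Finset.card_le_card fun p hp => by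
        have hp' := Nat.mem_primesBelow.1 (Finset.mem_filter.1 hp).1
        rw [Finset.mem_filter, Finset.mem_range]
        exact ⟨by omega, hp'.2⟩
    have hhalf : (2 / 5 : ℝ) * n ≤ ((n / 2 : ℕ) : ℝ) := by
      have : 2 * n ≤ 5 * (n / 2) := by omega
      have : (2 * n : ℝ) ≤ 5 * ((n / 2 : ℕ) : ℝ) := by exact_mod_cast this
      linarith
    have hnpos : (0 : ℝ) < n := by positivity
    have hS : ∑ p ∈ S, 1 / ((p : ℝ) - 1) ≤ 1 / 40 := by
      calc ∑ p ∈ S, 1 / ((p : ℝ) - 1) ≤ ∑ p ∈ S, 1 / ((2 / 5 : ℝ) * n) := by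
            refine Finset.sum_le_sum fun p hp => one_div_le_one_div_of_le (by positivity) ?_
            have : n / 2 + 1 ≤ p := (Finset.mem_filter.1 hp).2
            have : ((n / 2 : ℕ) : ℝ) + 1 ≤ p := by exact_mod_cast this
            linarith
        _ = S.card * (1 / ((2 / 5 : ℝ) * n)) := by rw [Finset.sum_const, nsmul_eq_mul]
        _ ≤ n / 100 * (1 / ((2 / 5 : ℝ) * n)) := by gcongr
        _ = 1 / 40 := by field_simp; norm_num
    have hlog : Real.log ((n / 2 + 1 : ℕ) : ℝ) ≤ Real.log n - 1 / 4 := by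
      have h35 : (((n / 2 + 1 : ℕ) : ℝ)) ≤ 3 / 5 * n := by
        have : 5 * (n / 2 + 1) ≤ 3 * n := by omega
        have : (5 * (n / 2 + 1 : ℕ) : ℝ) ≤ 3 * n := by exact_mod_cast this
        linarith
      have := Real.log_le_log (by positivity) h35
      rw [Real.log_mul (by norm_num) (by positivity)] at this
      have h2 := Real.log_le_sub_one_of_pos (show (0 : ℝ) < 3 / 5 by norm_num)
      linarith
    linarith

/-- A weak form of Mertens' upper bound, `∏_{p ≤ k} (1 - 1/p)⁻¹ ≪ k^{1/10}`. -/
lemma smoothSum_one_le : ∃ C : ℝ, 1 ≤ C ∧ ∀ k : ℕ, 1 ≤ k →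
    smoothSum 1 k ≤ C * (k : ℝ) ^ (1 / 10 : ℝ) := by
  obtain ⟨C, hC⟩ := sum_primesBelow_le
  refine ⟨max 1 (Real.exp (C + 1)), le_max_left _ _, fun k hk => ?_⟩
  have hk0 : (1 : ℝ) ≤ k := by exact_mod_cast hk
  have h1 : smoothSum 1 k ≤ Real.exp (∑ p ∈ Nat.primesBelow (k + 1), 1 / ((p : ℝ) - 1)) := by
    rw [Real.exp_sum]
    refine Finset.prod_le_prod (fun p hp => ?_) fun p hp => ?_
    · exact zero_le_one.trans (one_le_inv_one_sub_rpow one_pos (Nat.prime_of_mem_primesBelow hp))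
    · have hp2 : (2 : ℝ) ≤ p := by exact_mod_cast (Nat.prime_of_mem_primesBelow hp).two_le
      have : (1 - (p : ℝ) ^ (-(1:ℝ)))⁻¹ = 1 / ((p : ℝ) - 1) + 1 := by
        rw [Real.rpow_neg_one]
        have : (p : ℝ) - 1 ≠ 0 := by linarith
        have : (p : ℝ) ≠ 0 := by linarith
        field_simp
        ring
      rw [this]
      exact Real.add_one_le_exp _
  refine h1.trans ?_
  have h2 := hC (k + 1) (by omega)
  have h3 : Real.log ((k + 1 : ℕ) : ℝ) ≤ Real.log k + 1 := by
    have : ((k + 1 : ℕ) : ℝ) ≤ 2 * k := by push_cast; linarith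
    have := Real.log_le_log (by positivity) this
    rw [Real.log_mul (by norm_num) (by positivity)] at this
    linarith [Real.log_two_lt_d9]
  calc _ ≤ Real.exp (C + 1 + Real.log k * (1 / 10)) := Real.exp_le_exp.2 (by linarith)
    _ = Real.exp (C + 1) * (k : ℝ) ^ (1 / 10 : ℝ) := by
        rw [Real.exp_add, Real.rpow_def_of_pos (by linarith)]
    _ ≤ _ := by gcongr; exact le_max_right _ _

/-! ### Deterministic estimates for sums over blocks -/

section Deterministic

lemma e_add (x y : ℝ) : e (x + y) = e x * e y := by
  rw [e, e, e, ← Complex.exp_add]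
  push_cast
  ring_nf

lemma e_eq_exp_I (x : ℝ) : e x = Complex.exp (Complex.I * ((2 * Real.pi * x : ℝ) : ℂ)) := by
  rw [e]
  push_cast
  ring_nf

lemma norm_e (x : ℝ) : ‖e x‖ = 1 := by
  rw [e_eq_exp_I, mul_comm, Complex.norm_exp_ofReal_mul_I]

lemma norm_e_sub_e_le_rpow {α : ℝ} (h0 : 0 ≤ α) (h1 : α ≤ 1) (x y : ℝ) :
    ‖e x - e y‖ ≤ 2 * Real.pi * |x - y| ^ α := by
  have hpi := Real.two_le_pi
  rcases le_or_gt 1 |x - y| with h | h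
  · have : 1 ≤ |x - y| ^ α := Real.one_le_rpow h h0
    have h2 : ‖e x - e y‖ ≤ 2 := by
      refine (norm_sub_le _ _).trans ?_
      rw [norm_e, norm_e]
      norm_num
    nlinarith
  · have h2 : ‖e x - e y‖ ≤ 2 * Real.pi * |x - y| := by
      have : e x - e y = e y * (e (x - y) - 1) := by
        rw [mul_sub, ← e_add, mul_one]
        ring_nf
      rw [this, norm_mul, norm_e, one_mul, e_eq_exp_I]
      refine (Real.norm_exp_I_mul_ofReal_sub_one_le).trans ?_
      rw [Real.norm_eq_abs, abs_mul, abs_of_nonneg (by positivity)]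
    refine h2.trans (mul_le_mul_of_nonneg_left ?_ (by positivity))
    exact Real.self_le_rpow_of_le_one (abs_nonneg _) h.le h1

/-- The sum of `(1 - e(nt)) f(n) / n` over the nonzero integers `n` with `N < P⁺(|n|) ≤ k`. -/
noncomputable def blockSum (f : ℤ → ℂ) (N k : ℕ) (t : ℝ) : ℂ :=
  ∑' n : ℤ, (block N k).indicator (fun n : ℤ => (1 - e (n * t)) / (n : ℂ) * f n) n

lemma norm_intCast_inv (n : ℤ) : ‖(n : ℂ)‖⁻¹ = (n.natAbs : ℝ) ^ (-1 : ℝ) := by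
  rw [Real.rpow_neg_one, Complex.norm_intCast, Nat.cast_natAbs, Int.cast_abs]

variable {f : ℤ → ℂ}

lemma norm_term_le (hf : ∀ n, ‖f n‖ ≤ 1) (n : ℤ) (t : ℝ) :
    ‖(1 - e (n * t)) / (n : ℂ) * f n‖ ≤ 2 * (n.natAbs : ℝ) ^ (-1 : ℝ) := by
  rw [norm_mul, norm_div, div_eq_mul_inv, norm_intCast_inv]
  have h : ‖1 - e (n * t)‖ ≤ 2 := by
    refine (norm_sub_le _ _).trans ?_
    rw [norm_e, norm_one]
    norm_num
  calc _ ≤ 2 * (n.natAbs : ℝ) ^ (-1 : ℝ) * 1 := by gcongr; exact hf n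
    _ = _ := mul_one _

lemma norm_indicator_term_le (hf : ∀ n, ‖f n‖ ≤ 1) (N k : ℕ) (t : ℝ) (n : ℤ) :
    ‖(block N k).indicator (fun n : ℤ => (1 - e (n * t)) / (n : ℂ) * f n) n‖ ≤
      2 * (block N k).indicator (fun n : ℤ => (n.natAbs : ℝ) ^ (-1 : ℝ)) n := by
  by_cases h : n ∈ block N k
  · rw [Set.indicator_of_mem h, Set.indicator_of_mem h]
    exact norm_term_le hf n t
  · rw [Set.indicator_of_notMem h, Set.indicator_of_notMem h]
    simp

lemma summable_norm_blockSum (hf : ∀ n, ‖f n‖ ≤ 1) (N k : ℕ) (t : ℝ) :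
    Summable fun n : ℤ =>
      ‖(block N k).indicator (fun n : ℤ => (1 - e (n * t)) / (n : ℂ) * f n) n‖ :=
  Summable.of_nonneg_of_le (fun _ => norm_nonneg _) (norm_indicator_term_le hf N k t)
    ((summable_block one_pos N k).mul_left 2)

lemma summable_blockSum (hf : ∀ n, ‖f n‖ ≤ 1) (N k : ℕ) (t : ℝ) :
    Summable ((block N k).indicator fun n : ℤ => (1 - e (n * t)) / (n : ℂ) * f n) :=
  (summable_norm_blockSum hf N k t).of_norm

lemma blockSum_add (hf : ∀ n, ‖f n‖ ≤ 1) {N k l : ℕ} (h1 : N ≤ k) (h2 : k ≤ l) (t : ℝ) :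
    blockSum f N k t + blockSum f k l t = blockSum f N l t := by
  have hu : block N l = block N k ∪ block k l := by
    ext n
    change (_ ∧ _ ∧ _) ↔ (_ ∧ _ ∧ _) ∨ (_ ∧ _ ∧ _)
    omega
  have hd : Disjoint (block N k) (block k l) :=
    Set.disjoint_left.2 fun n hn hn' => absurd hn.2.2 (not_le.2 hn'.2.1)
  rw [blockSum, blockSum, blockSum, hu, Set.indicator_union_of_disjoint hd,
    ← (summable_blockSum hf N k t).tsum_add (summable_blockSum hf k l t)]

lemma blockSum_self (N : ℕ) (t : ℝ) : blockSum f N N t = 0 := by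
  have : block N N = ∅ := Set.eq_empty_of_forall_notMem fun n hn => absurd hn.2.1 (not_lt.2 hn.2.2)
  simp [blockSum, this]

lemma norm_blockSum_pred_le (hf : ∀ n, ‖f n‖ ≤ 1) {p : ℕ} (hp : 1 < p) (t : ℝ) :
    ‖blockSum f (p - 1) p t‖ ≤ 4 * smoothSum 1 p / p := by
  refine (norm_tsum_le_tsum_norm (summable_norm_blockSum hf _ _ t)).trans ?_
  refine (Summable.tsum_le_tsum (norm_indicator_term_le hf (p - 1) p t)
    (summable_norm_blockSum hf _ _ t) ((summable_block one_pos _ _).mul_left 2)).trans ?_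
  rw [tsum_mul_left]
  refine (mul_le_mul_of_nonneg_left (tsum_block_pred_le hp) zero_le_two).trans_eq ?_
  ring

/-- Hölder continuity of block sums, with the tiny exponent `1 / (3 log K)`; no better regularity is
uniform over the `K`-smooth integers. -/
lemma norm_blockSum_sub_le (hf : ∀ n, ‖f n‖ ≤ 1) {N k K : ℕ} (hK : 2 ≤ K) (hk : k ≤ K)
    (s t : ℝ) :
    ‖blockSum f N k t - blockSum f N k s‖ ≤
      4 * Real.pi * |t - s| ^ (1 / (3 * Real.log K)) * smoothSum 1 K ^ 2 := by
  set α := 1 / (3 * Real.log K) with hα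
  have hlog : Real.log 2 ≤ Real.log K :=
    Real.log_le_log two_pos (by exact_mod_cast hK)
  have hlog2 := Real.log_two_gt_d9
  have hpos : 0 < Real.log K := by linarith
  have hα0 : 0 < α := by rw [hα]; positivity
  have hα1 : α < 1 := by
    rw [hα, div_lt_one (by positivity)]
    linarith
  have hle : ∀ n : ℤ,
      ‖(block N k).indicator (fun n : ℤ => (1 - e (n * t)) / (n : ℂ) * f n) n -
        (block N k).indicator (fun n : ℤ => (1 - e (n * s)) / (n : ℂ) * f n) n‖ ≤
      2 * Real.pi * |t - s| ^ α *
        (block N K).indicator (fun n : ℤ => (n.natAbs : ℝ) ^ (-(1 - α))) n := by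
    intro n
    by_cases h : n ∈ block N k
    · have h' : n ∈ block N K := ⟨h.1, h.2.1, h.2.2.trans hk⟩
      rw [Set.indicator_of_mem h, Set.indicator_of_mem h, Set.indicator_of_mem h', ← sub_mul,
        ← sub_div, sub_sub_sub_cancel_left, norm_mul, norm_div, div_eq_mul_inv, norm_intCast_inv]
      have hn0 : (0 : ℝ) < n.natAbs := by
        have := h.1
        exact_mod_cast Int.natAbs_pos.2 this
      have h1 : ‖e (n * s) - e (n * t)‖ ≤
          2 * Real.pi * ((n.natAbs : ℝ) ^ α * |t - s| ^ α) := by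
        refine (norm_e_sub_e_le_rpow hα0.le hα1.le _ _).trans_eq ?_
        rw [← mul_sub, abs_mul, Real.mul_rpow (abs_nonneg _) (abs_nonneg _), Nat.cast_natAbs,
          Int.cast_abs, abs_sub_comm s t]
      calc _ ≤ 2 * Real.pi * ((n.natAbs : ℝ) ^ α * |t - s| ^ α) *
            (n.natAbs : ℝ) ^ (-1 : ℝ) * 1 := by gcongr; exact hf n
        _ = _ := by
          rw [show -(1 - α) = α + -1 by ring, Real.rpow_add hn0]
          ring
    · rw [Set.indicator_of_notMem h, Set.indicator_of_notMem h, sub_zero, norm_zero]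
      exact mul_nonneg (by positivity) (Set.indicator_nonneg (fun _ _ => by positivity) _)
  have hs := (summable_block (σ := 1 - α) (by linarith) N K).mul_left
    (2 * Real.pi * |t - s| ^ α)
  rw [blockSum, blockSum, ← (summable_blockSum hf N k t).tsum_sub (summable_blockSum hf N k s)]
  refine (tsum_of_norm_bounded hs.hasSum hle).trans ?_
  rw [tsum_mul_left]
  have h2 := (tsum_block_le (σ := 1 - α) (by linarith) N K).trans
    (mul_le_mul_of_nonneg_left (smoothSum_le_sq hK) zero_le_two)
  refine (mul_le_mul_of_nonneg_left h2 (by positivity)).trans_eq ?_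
  ring

end Deterministic

/-! ### The normalised random multiplicative function -/

section Normalised

variable {Ω : Type*}

/-- The independent variables behind `X`: `X_{-1}` at the index `none`, `X_p` at the index `p`. -/
def coord (X : ℤ → Ω → ℂ) (i : Option Nat.Primes) : Ω → ℂ :=
  i.elim (X (-1)) (fun p => X ((p : ℕ) : ℤ))

/-- The identity on the unit circle, extended by the value `1`. -/
noncomputable def unitize (z : ℂ) : ℂ := if ‖z‖ = 1 then z else 1

lemma norm_unitize (z : ℂ) : ‖unitize z‖ = 1 := by
  unfold unitize
  split_ifs with h
  · exact h
  · exact norm_one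

lemma measurable_unitize : Measurable unitize :=
  Measurable.ite (measurableSet_eq_fun measurable_norm measurable_const) measurable_id
    measurable_const

/-- The multiplicative function built from the variables `unitize (X_p)` and `unitize (X_{-1})`. It
is unimodular everywhere, and agrees with `X` almost surely. -/
noncomputable def unitRMF (X : ℤ → Ω → ℂ) (n : ℤ) (ω : Ω) : ℂ :=
  (if n < 0 then unitize (X (-1) ω) else 1) *
    ∏ p ∈ n.natAbs.primeFactors, unitize (X p ω) ^ n.natAbs.factorization p

lemma norm_unitRMF (X : ℤ → Ω → ℂ) (n : ℤ) (ω : Ω) : ‖unitRMF X n ω‖ = 1 := by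
  unfold unitRMF
  rw [norm_mul, norm_prod]
  have h1 : ‖(if n < 0 then unitize (X (-1) ω) else 1 : ℂ)‖ = 1 := by
    split_ifs
    · exact norm_unitize _
    · exact norm_one
  simp [h1, norm_unitize]

/-- The information carried by `X_{-1}` and the `X_p` with `p ≤ k`. -/
@[reducible] noncomputable def primeSigma (X : ℤ → Ω → ℂ) (k : ℕ) : MeasurableSpace Ω :=
  ⨆ i ∈ {i : Option Nat.Primes | ∀ p ∈ i, (p : ℕ) ≤ k},
    MeasurableSpace.comap (fun ω => unitize (coord X i ω)) inferInstance

lemma primeSigma_mono (X : ℤ → Ω → ℂ) {k l : ℕ} (h : k ≤ l) : primeSigma X k ≤ primeSigma X l :=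
  biSup_mono fun _ hi p hp => (hi p hp).trans h

lemma measurable_coord_primeSigma (X : ℤ → Ω → ℂ) {k : ℕ} {i : Option Nat.Primes}
    (hi : ∀ p ∈ i, (p : ℕ) ≤ k) : Measurable[primeSigma X k] fun ω => unitize (coord X i ω) :=
  Measurable.mono (comap_measurable _)
    (le_biSup (fun i => MeasurableSpace.comap (fun ω => unitize (coord X i ω)) inferInstance) hi)
    le_rfl

lemma measurable_sign_primeSigma (X : ℤ → Ω → ℂ) (k : ℕ) (n : ℤ) :
    Measurable[primeSigma X k] fun ω => if n < 0 then unitize (X (-1) ω) else 1 := by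
  split_ifs
  · exact measurable_coord_primeSigma X (i := none) (by simp)
  · exact measurable_const

lemma measurable_prod_primeSigma (X : ℤ → Ω → ℂ) (k : ℕ) (s : Finset ℕ) (a : ℕ → ℕ)
    (hs : ∀ p ∈ s, p.Prime ∧ p ≤ k) :
    Measurable[primeSigma X k] fun ω => ∏ p ∈ s, unitize (X p ω) ^ a p := by
  refine Finset.measurable_prod (m := primeSigma X k) s fun p hp => Measurable.pow_const ?_ _
  exact measurable_coord_primeSigma X (i := some ⟨p, (hs p hp).1⟩)
    fun q hq => by
      rw [← Option.mem_some_iff.1 hq]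
      exact (hs p hp).2

lemma measurable_unitRMF (X : ℤ → Ω → ℂ) {N k : ℕ} {n : ℤ} (hn : n ∈ block N k) :
    Measurable[primeSigma X k] (unitRMF X n) := by
  refine (measurable_sign_primeSigma X k n).mul
    (measurable_prod_primeSigma X k _ _ fun p hp => ⟨Nat.prime_of_mem_primeFactors hp, ?_⟩)
  exact (largestPrimeFactor_le_iff ((one_le_largestPrimeFactor _).trans hn.2.2)).1 hn.2.2 p hp

lemma measurable_tsum_of_summable {ι : Type*} [Countable ι] {m : MeasurableSpace Ω}
    {g : ι → Ω → ℂ} (hg : ∀ i, Measurable (g i)) (hs : ∀ ω, Summable fun i => g i ω) :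
    Measurable fun ω => ∑' i, g i ω :=
  measurable_of_tendsto_metrizable' (atTop : Filter (Finset ι))
    (f := fun s ω => ∑ i ∈ s, g i ω) (fun s => Finset.measurable_fun_sum s fun i _ => hg i)
    (tendsto_pi_nhds.2 fun ω => (hs ω).hasSum)

lemma measurable_indicator_term (X : ℤ → Ω → ℂ) (N k : ℕ) (t : ℝ) (n : ℤ) :
    Measurable[primeSigma X k] fun ω => (block N k).indicator
      (fun n : ℤ => (1 - e (n * t)) / (n : ℂ) * unitRMF X n ω) n := by
  by_cases h : n ∈ block N k
  · simp only [Set.indicator_of_mem h]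
    exact (measurable_unitRMF X h).const_mul _
  · simp only [Set.indicator_of_notMem h]
    exact measurable_const

lemma measurable_blockSum (X : ℤ → Ω → ℂ) (N k : ℕ) (t : ℝ) :
    Measurable[primeSigma X k] fun ω => blockSum (fun n => unitRMF X n ω) N k t :=
  measurable_tsum_of_summable (measurable_indicator_term X N k t) fun ω =>
    summable_blockSum (fun n => (norm_unitRMF X n ω).le) N k t

section Steinhaus

variable [MeasurableSpace Ω] {μ : Measure Ω} {X : ℤ → Ω → ℂ}

lemma measurable_e : Measurable e := by
  unfold e
  fun_prop

lemma uniformCircle_ae_norm : ∀ᵐ z ∂uniformCircle, ‖z‖ = 1 := by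
  rw [uniformCircle, ae_map_iff measurable_e.aemeasurable
    (measurableSet_eq_fun measurable_norm measurable_const)]
  exact Eventually.of_forall norm_e

/-- The nontrivial characters of the circle have mean zero. -/
lemma integral_uniformCircle_pow {a : ℕ} (ha : a ≠ 0) : ∫ z, z ^ a ∂uniformCircle = 0 := by
  rw [uniformCircle, integral_map measurable_e.aemeasurable (by fun_prop),
    integral_Icc_eq_integral_Ioc, ← intervalIntegral.integral_of_le zero_le_one]
  have hc : (2 * Real.pi * Complex.I * a : ℂ) ≠ 0 := by
    simp [Real.pi_ne_zero, ha]
  have : ∀ θ : ℝ, e θ ^ a = Complex.exp (2 * Real.pi * Complex.I * a * θ) := by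
    intro θ
    rw [e, ← Complex.exp_nat_mul]
    ring_nf
  simp_rw [this]
  rw [integral_exp_mul_complex hc]
  have h1 : Complex.exp (2 * Real.pi * Complex.I * a * (1 : ℝ)) = 1 := by
    rw [Complex.exp_eq_one_iff]
    exact ⟨a, by push_cast; ring⟩
  rw [h1]
  simp

namespace IsSteinhausRMF

lemma measurable_coord (h : IsSteinhausRMF X μ) (i : Option Nat.Primes) :
    Measurable (coord X i) := by
  cases i with
  | none => exact h.measurable_neg_one
  | some p => exact h.measurable_prime p

lemma primeSigma_le (h : IsSteinhausRMF X μ) (k : ℕ) : primeSigma X k ≤ ‹MeasurableSpace Ω› :=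
  iSup₂_le fun i _ => (measurable_unitize.comp (h.measurable_coord i)).comap_le

lemma ae_unitize_prime (h : IsSteinhausRMF X μ) (p : Nat.Primes) :
    ∀ᵐ ω ∂μ, unitize (X ((p : ℕ) : ℤ) ω) = X ((p : ℕ) : ℤ) ω := by
  have h1 := uniformCircle_ae_norm
  rw [← h.law_prime p] at h1
  filter_upwards [ae_of_ae_map (h.measurable_prime p).aemeasurable h1] with ω hω
  rw [unitize, if_pos hω]

lemma ae_unitize_neg_one (h : IsSteinhausRMF X μ) :
    ∀ᵐ ω ∂μ, unitize (X (-1) ω) = X (-1) ω := by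
  have h1 : ∀ᵐ z ∂μ.map (X (-1)), ‖z‖ = 1 := by
    rw [h.law_neg_one]
    refine Measure.ae_smul_measure ?_ _
    rw [ae_add_measure_iff]
    have hm : MeasurableSet {z : ℂ | ‖z‖ = 1} :=
      measurableSet_eq_fun measurable_norm measurable_const
    exact ⟨(ae_dirac_iff hm).2 norm_one, (ae_dirac_iff hm).2 (by simp)⟩
  filter_upwards [ae_of_ae_map h.measurable_neg_one.aemeasurable h1] with ω hω
  rw [unitize, if_pos hω]

lemma ae_unitRMF_eq (h : IsSteinhausRMF X μ) :
    ∀ᵐ ω ∂μ, ∀ n : ℤ, n ≠ 0 → unitRMF X n ω = X n ω := by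
  filter_upwards [ae_all_iff.2 h.ae_unitize_prime, h.ae_unitize_neg_one] with ω h1 h2 n hn
  have hpos : 0 < n.natAbs := Int.natAbs_pos.2 hn
  have h3 : ∏ p ∈ n.natAbs.primeFactors, unitize (X p ω) ^ n.natAbs.factorization p =
      X (n.natAbs : ℤ) ω := by
    rw [h.apply_pos _ hpos]
    refine Finset.prod_congr rfl fun p hp => ?_
    rw [h1 ⟨p, Nat.prime_of_mem_primeFactors hp⟩]
  rw [unitRMF, h3, h2]
  split_ifs with hneg
  · rw [← h.apply_neg _ hpos, Int.ofNat_natAbs_of_nonpos hneg.le, neg_neg]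
  · rw [one_mul, Int.natAbs_of_nonneg (not_lt.1 hneg)]

lemma indep_primeSigma (h : IsSteinhausRMF X μ) {p : ℕ} (hp : p.Prime) :
    Indep (primeSigma X (p - 1))
      (MeasurableSpace.comap (fun ω => unitize (X (p : ℤ) ω)) inferInstance) μ := by
  have hi : iIndepFun (fun i ω => unitize (coord X i ω)) μ :=
    h.indep.comp (fun _ => unitize) fun _ => measurable_unitize
  have := indep_iSup_of_disjoint
    (fun i => (measurable_unitize.comp (h.measurable_coord i)).comap_le) hi.iIndep
    (S := {i : Option Nat.Primes | ∀ q ∈ i, (q : ℕ) ≤ p - 1}) (T := {some ⟨p, hp⟩}) (by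
      rw [Set.disjoint_singleton_right]
      intro hmem
      have := hmem ⟨p, hp⟩ rfl
      have := hp.one_lt
      simp only at *
      omega)
  rw [iSup_singleton] at this
  exact this

lemma integral_unitize_pow (h : IsSteinhausRMF X μ) {p : ℕ} (hp : p.Prime) {a : ℕ}
    (ha : a ≠ 0) : ∫ ω, unitize (X (p : ℤ) ω) ^ a ∂μ = 0 := by
  have h1 : ∫ ω, unitize (X (p : ℤ) ω) ^ a ∂μ = ∫ ω, X (p : ℤ) ω ^ a ∂μ :=
    integral_congr_ae ((h.ae_unitize_prime ⟨p, hp⟩).mono fun ω hω => by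
      simp only at hω ⊢
      rw [hω])
  rw [h1, ← integral_map (φ := X (p : ℤ)) (f := fun z => z ^ a)
    (h.measurable_prime ⟨p, hp⟩).aemeasurable (by fun_prop), h.law_prime ⟨p, hp⟩,
    integral_uniformCircle_pow ha]

/-- An integer `n` with largest prime factor `p` is exactly divisible by some `p ^ a` with `a ≥ 1`,
and `X_p ^ a` has mean zero and is independent of the smaller primes. -/
lemma integral_mul_unitRMF (h : IsSteinhausRMF X μ) {p : ℕ} (hp : 1 < p) {n : ℤ}
    (hn : n ∈ block (p - 1) p) {W : Ω → ℂ} (hW : Measurable[primeSigma X (p - 1)] W) :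
    ∫ ω, W ω * unitRMF X n ω ∂μ = 0 := by
  obtain ⟨hpp, hdvd⟩ := prime_dvd_of_mem_block hp hn
  have hmem : p ∈ n.natAbs.primeFactors :=
    Nat.mem_primeFactors.2 ⟨hpp, hdvd, by simpa using hn.1⟩
  set a := n.natAbs.factorization p
  have ha : a ≠ 0 := (hpp.factorization_pos_of_dvd (by simpa using hn.1) hdvd).ne'
  set V : Ω → ℂ := fun ω => W ω * ((if n < 0 then unitize (X (-1) ω) else 1) *
    ∏ q ∈ n.natAbs.primeFactors.erase p, unitize (X q ω) ^ n.natAbs.factorization q) with hV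
  have hVm : Measurable[primeSigma X (p - 1)] V := by
    refine hW.mul ((measurable_sign_primeSigma X _ n).mul
      (measurable_prod_primeSigma X _ _ _ fun q hq => ?_))
    obtain ⟨hne, hq⟩ := Finset.mem_erase.1 hq
    have hle := (largestPrimeFactor_le_iff hp.le).1 hn.2.2 q hq
    exact ⟨Nat.prime_of_mem_primeFactors hq, by omega⟩
  have heq : ∀ ω, W ω * unitRMF X n ω = V ω * unitize (X (p : ℤ) ω) ^ a := by
    intro ω
    rw [unitRMF, ← Finset.mul_prod_erase _ _ hmem, hV]
    ring
  simp_rw [heq]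
  have hind : IndepFun V (fun ω => unitize (X (p : ℤ) ω) ^ a) μ := by
    rw [IndepFun_iff_Indep]
    refine indep_of_indep_of_le (h.indep_primeSigma hpp) hVm.comap_le ?_
    exact ((comap_measurable fun ω => unitize (X (p : ℤ) ω)).pow_const a).comap_le
  rw [hind.integral_fun_mul_eq_mul_integral
    (hVm.mono (h.primeSigma_le _) le_rfl).aestronglyMeasurable
    ((measurable_unitize.comp (h.measurable_prime ⟨p, hpp⟩)).pow_const a).aestronglyMeasurable,
    h.integral_unitize_pow hpp ha, mul_zero]

/-- The blocks of consecutive primes are martingale differences. -/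
lemma integral_mul_blockSum_pred [IsProbabilityMeasure μ] (h : IsSteinhausRMF X μ) {p : ℕ}
    (hp : 1 < p) (t : ℝ) {W : Ω → ℂ} (hW : Measurable[primeSigma X (p - 1)] W) {C : ℝ}
    (hC : ∀ ω, ‖W ω‖ ≤ C) :
    ∫ ω, W ω * blockSum (fun n => unitRMF X n ω) (p - 1) p t ∂μ = 0 := by
  have hC0 : 0 ≤ C := by
    have : Nonempty Ω := nonempty_of_isProbabilityMeasure μ
    exact (norm_nonneg _).trans (hC (Classical.arbitrary Ω))
  set g : ℤ → Ω → ℂ := fun n ω => W ω * (block (p - 1) p).indicator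
    (fun n : ℤ => (1 - e (n * t)) / (n : ℂ) * unitRMF X n ω) n with hg
  have hgm : ∀ n, Measurable (g n) := fun n =>
    (hW.mono (h.primeSigma_le _) le_rfl).mul
      ((measurable_indicator_term X (p - 1) p t n).mono (h.primeSigma_le _) le_rfl)
  have hgb : ∀ n ω, ‖g n ω‖ ≤ C * (2 * (block (p - 1) p).indicator
      (fun n : ℤ => (n.natAbs : ℝ) ^ (-1 : ℝ)) n) := by
    intro n ω
    rw [hg, norm_mul]
    exact mul_le_mul (hC ω) (norm_indicator_term_le (fun n => (norm_unitRMF X n ω).le) _ _ t n)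
      (norm_nonneg _) hC0
  have hgi : ∀ n, Integrable (g n) μ := fun n =>
    Integrable.of_bound (hgm n).aestronglyMeasurable _ (Eventually.of_forall (hgb n))
  have hsum : Summable fun n => ∫ ω, ‖g n ω‖ ∂μ := by
    refine Summable.of_nonneg_of_le (fun n => integral_nonneg fun ω => norm_nonneg _) (fun n => ?_)
      (((summable_block one_pos (p - 1) p).mul_left 2).mul_left C)
    refine (integral_mono (hgi n).norm (integrable_const _) (hgb n)).trans_eq ?_
    simp
  have key := integral_tsum_of_summable_integral_norm hgi hsum
  have hz : ∀ n, ∫ ω, g n ω ∂μ = 0 := by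
    intro n
    by_cases hn : n ∈ block (p - 1) p
    · simp only [hg, Set.indicator_of_mem hn]
      have := h.integral_mul_unitRMF hp hn (hW.mul_const ((1 - e (n * t)) / (n : ℂ)))
      simpa only [mul_assoc] using this
    · simp [hg, Set.indicator_of_notMem hn]
  simp only [hz, tsum_zero] at key
  refine Eq.trans ?_ key.symm
  refine integral_congr_ae (Eventually.of_forall fun ω => ?_)
  simp only [hg]
  rw [tsum_mul_left, blockSum]

end IsSteinhausRMF

end Steinhaus

end Normalised

/-! ### Large deviations for a fixed argument -/

section FixedArgument

variable {Ω : Type*}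

/-- The sum of `(1 - e(nt)) X_n / n` over `N < P⁺(|n|) ≤ k`, for the unimodular version of `X`. -/
noncomputable def randomBlock (X : ℤ → Ω → ℂ) (N k : ℕ) (t : ℝ) (ω : Ω) : ℂ :=
  blockSum (fun n => unitRMF X n ω) N k t

lemma norm_blockSum_le {f : ℤ → ℂ} (hf : ∀ n, ‖f n‖ ≤ 1) (N k : ℕ) (t : ℝ) :
    ‖blockSum f N k t‖ ≤ 4 * smoothSum 1 k := by
  refine (norm_tsum_le_tsum_norm (summable_norm_blockSum hf _ _ t)).trans ?_
  refine (Summable.tsum_le_tsum (norm_indicator_term_le hf N k t)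
    (summable_norm_blockSum hf _ _ t) ((summable_block one_pos _ _).mul_left 2)).trans ?_
  rw [tsum_mul_left]
  linarith [tsum_block_le one_pos N k]

lemma exp_le_cosh_add {b d : ℝ} (h : |d| ≤ b) :
    Real.exp d ≤ Real.cosh b + d * (Real.sinh b / b) := by
  rcases eq_or_ne b 0 with rfl | hb
  · have : d = 0 := by simpa using h
    simp [this]
  · have hb0 : 0 < b := lt_of_le_of_ne ((abs_nonneg d).trans h) hb.symm
    have h1 : |d / b| ≤ 1 := by
      rw [abs_div, abs_of_pos hb0]
      exact (div_le_one hb0).2 h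
    have := Real.exp_mul_le_cosh_add_mul_sinh h1 b
    rw [div_mul_cancel₀ _ hb] at this
    refine this.trans_eq ?_
    ring

/-- The bound `4 L(p) / p` for the martingale difference at `p`, where `L(p)` is the sum of the
reciprocals of the `p`-smooth integers. -/
noncomputable def incrementBound (p : ℕ) : ℝ := 4 * smoothSum 1 p / p

variable [MeasurableSpace Ω] {μ : Measure Ω} {X : ℤ → Ω → ℂ}

namespace IsSteinhausRMF

lemma measurable_randomBlock (h : IsSteinhausRMF X μ) (N k : ℕ) (t : ℝ) :
    Measurable (randomBlock X N k t) :=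
  (measurable_blockSum X N k t).mono (h.primeSigma_le k) le_rfl

variable [IsProbabilityMeasure μ]

/-- Azuma's inequality for exponential moments, conditionally on the primes up to `N`: the linear
term of `exp_le_cosh_add` integrates to zero. -/
lemma integral_exp_randomBlock_le (h : IsSteinhausRMF X μ) {N : ℕ} (hN : 1 ≤ N) (t : ℝ) {A : Set Ω}
    (hA : MeasurableSet[primeSigma X N] A) (w : ℂ) {k : ℕ} (hk : N ≤ k) :
    ∫ ω, A.indicator 1 ω * Real.exp (w * randomBlock X N k t ω).re ∂μ ≤
      μ.real A * Real.exp (‖w‖ ^ 2 / 2 * ∑ p ∈ Finset.Ioc N k, incrementBound p ^ 2) := by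
  have hAm : MeasurableSet A := h.primeSigma_le N A hA
  have hre : ∀ N k ω, |(w * randomBlock X N k t ω).re| ≤ ‖w‖ * ‖randomBlock X N k t ω‖ :=
    fun N k ω => (Complex.abs_re_le_norm _).trans_eq (norm_mul _ _)
  have hu : ∀ n ω, ‖unitRMF X n ω‖ ≤ 1 := fun n ω => (norm_unitRMF X n ω).le
  induction k, hk using Nat.le_induction with
  | base =>
    simp only [randomBlock, blockSum_self, mul_zero, Complex.zero_re, Real.exp_zero, mul_one,
      Finset.Ioc_self, Finset.sum_empty]
    rw [integral_indicator_one hAm]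
  | succ k hk ih =>
    set p := k + 1 with hp
    have hp1 : 1 < p := by omega
    set b := ‖w‖ * incrementBound p with hb
    set W : Ω → ℝ := fun ω => A.indicator 1 ω * Real.exp (w * randomBlock X N k t ω).re with hW
    set d : Ω → ℝ := fun ω => (w * randomBlock X k p t ω).re with hd
    have hdb : ∀ ω, |d ω| ≤ b := fun ω => (hre k p ω).trans
      (mul_le_mul_of_nonneg_left (norm_blockSum_pred_le (fun n => hu n ω) hp1 t) (norm_nonneg _))
    have hind : ∀ ω, 0 ≤ A.indicator (1 : Ω → ℝ) ω ∧ A.indicator (1 : Ω → ℝ) ω ≤ 1 := fun ω =>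
      ⟨Set.indicator_nonneg (fun _ _ => zero_le_one) _,
        Set.indicator_le_self' (fun _ _ => zero_le_one) _⟩
    have hW0 : ∀ ω, 0 ≤ W ω := fun ω => mul_nonneg (hind ω).1 (Real.exp_nonneg _)
    have hWm : Measurable[primeSigma X k] W := by
      refine Measurable.mul ?_ (Real.measurable_exp.comp (Complex.measurable_re.comp
        ((measurable_blockSum X N k t).const_mul w)))
      have h1 : Measurable[primeSigma X k] (1 : Ω → ℝ) := measurable_const
      exact h1.indicator (primeSigma_mono X hk A hA)
    have hWC : ∀ ω, ‖W ω‖ ≤ Real.exp (‖w‖ * (4 * smoothSum 1 k)) := by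
      intro ω
      rw [Real.norm_of_nonneg (hW0 ω)]
      refine (mul_le_of_le_one_left (Real.exp_nonneg _) (hind ω).2).trans (Real.exp_le_exp.2 ?_)
      exact (le_abs_self _).trans ((hre N k ω).trans
        (mul_le_mul_of_nonneg_left (norm_blockSum_le (fun n => hu n ω) N k t) (norm_nonneg _)))
    have hWi : Integrable W μ := Integrable.of_bound
      (hWm.mono (h.primeSigma_le k) le_rfl).aestronglyMeasurable _ (Eventually.of_forall hWC)
    have hdm : Measurable d := Complex.measurable_re.comp
      ((h.measurable_randomBlock k p t).const_mul w)
    have hWd : Integrable (fun ω => W ω * d ω) μ :=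
      hWi.mul_bdd (c := b) hdm.aestronglyMeasurable (Eventually.of_forall hdb)
    have hmart : ∫ ω, W ω * d ω ∂μ = 0 := by
      have h1 := h.integral_mul_blockSum_pred hp1 t (W := fun ω => (W ω : ℂ) * w)
        ((Complex.measurable_ofReal.comp hWm).mul_const w)
        (C := Real.exp (‖w‖ * (4 * smoothSum 1 k)) * ‖w‖) (fun ω => by
          rw [norm_mul, Complex.norm_real]
          exact mul_le_mul_of_nonneg_right (hWC ω) (norm_nonneg _))
      have h2 : Integrable (fun ω => (W ω : ℂ) * w * randomBlock X k p t ω) μ := by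
        refine (hWi.ofReal.mul_const w).mul_bdd (c := 4 * smoothSum 1 p)
          (h.measurable_randomBlock k p t).aestronglyMeasurable
          (Eventually.of_forall fun ω => norm_blockSum_le (fun n => hu n ω) k p t)
      have h3 := integral_re h2
      have h4 : ∀ ω, RCLike.re ((W ω : ℂ) * w * randomBlock X k p t ω) = W ω * d ω := by
        intro ω
        rw [mul_assoc]
        exact Complex.re_ofReal_mul _ _
      simp only [h4] at h3
      rw [h3]
      exact (congrArg RCLike.re h1).trans (map_zero _)
    have hstep : ∀ ω, A.indicator 1 ω * Real.exp (w * randomBlock X N p t ω).re ≤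
        Real.cosh b * W ω + Real.sinh b / b * (W ω * d ω) := by
      intro ω
      have : randomBlock X N p t ω = randomBlock X N k t ω + randomBlock X k p t ω :=
        (blockSum_add (fun n => hu n ω) hk (Nat.le_succ k) t).symm
      rw [this, mul_add, Complex.add_re, Real.exp_add, ← mul_assoc]
      refine (mul_le_mul_of_nonneg_left (exp_le_cosh_add (hdb ω)) (hW0 ω)).trans_eq ?_
      simp only [hd]
      ring
    have hint : Integrable (fun ω => Real.cosh b * W ω + Real.sinh b / b * (W ω * d ω)) μ :=
      (hWi.const_mul _).add (hWd.const_mul _)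
    calc _ ≤ ∫ ω, (Real.cosh b * W ω + Real.sinh b / b * (W ω * d ω)) ∂μ :=
          integral_mono_of_nonneg (Eventually.of_forall fun ω =>
            mul_nonneg (hind ω).1 (Real.exp_nonneg _)) hint (Eventually.of_forall hstep)
      _ = Real.cosh b * ∫ ω, W ω ∂μ := by
          rw [integral_add (hWi.const_mul _) (hWd.const_mul _), integral_const_mul,
            integral_const_mul, hmart, mul_zero, add_zero]
      _ ≤ Real.exp (b ^ 2 / 2) * (μ.real A *
            Real.exp (‖w‖ ^ 2 / 2 * ∑ p ∈ Finset.Ioc N k, incrementBound p ^ 2)) := by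
          refine mul_le_mul (Real.cosh_le_exp_half_sq b) ih (integral_nonneg hW0)
            (Real.exp_nonneg _)
      _ = _ := by
          rw [← Finset.insert_Ioc_right_eq_Ioc_add_one hk, Finset.sum_insert (by simp),
            mul_add, Real.exp_add, hb, ← hp]
          ring_nf

lemma measure_le_re_randomBlock_le (h : IsSteinhausRMF X μ) {N k : ℕ} (hN : 1 ≤ N) (hk : N ≤ k)
    (t : ℝ) {A : Set Ω} (hA : MeasurableSet[primeSigma X N] A) {w : ℂ} (hw : ‖w‖ = 1) {V δ : ℝ}
    (hV : 0 < V) (hVs : ∑ p ∈ Finset.Ioc N k, incrementBound p ^ 2 ≤ V) (hδ : 0 < δ) :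
    μ (A ∩ {ω | δ ≤ (w * randomBlock X N k t ω).re}) ≤
      ENNReal.ofReal (Real.exp (-(δ ^ 2 / (2 * V)))) * μ A := by
  have hAm : MeasurableSet A := h.primeSigma_le N A hA
  have hE : MeasurableSet {ω | δ ≤ (w * randomBlock X N k t ω).re} :=
    measurableSet_le measurable_const
      (Complex.measurable_re.comp ((h.measurable_randomBlock N k t).const_mul w))
  -- the optimal Chernoff parameter
  set l := δ / V with hl
  have hl0 : 0 < l := by positivity
  have hmgf := h.integral_exp_randomBlock_le hN t hA (l * w) hk
  have hnorm : ‖(l * w : ℂ)‖ = l := by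
    rw [norm_mul, hw, mul_one, Complex.norm_real, Real.norm_of_nonneg hl0.le]
  have hre : ∀ ω, (l * w * randomBlock X N k t ω).re = l * (w * randomBlock X N k t ω).re := by
    intro ω
    rw [mul_assoc]
    exact Complex.re_ofReal_mul _ _
  simp only [hnorm, hre] at hmgf
  have hbound : ∀ ω, ‖A.indicator (1 : Ω → ℝ) ω * Real.exp (l * (w * randomBlock X N k t ω).re)‖ ≤
      Real.exp (l * (4 * smoothSum 1 k)) := by
    intro ω
    have h1 : A.indicator (1 : Ω → ℝ) ω ≤ 1 := Set.indicator_le_self' (fun _ _ => zero_le_one) _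
    have h0 : 0 ≤ A.indicator (1 : Ω → ℝ) ω := Set.indicator_nonneg (fun _ _ => zero_le_one) _
    rw [Real.norm_of_nonneg (mul_nonneg h0 (Real.exp_nonneg _))]
    refine (mul_le_of_le_one_left (Real.exp_nonneg _) h1).trans (Real.exp_le_exp.2 ?_)
    refine mul_le_mul_of_nonneg_left ?_ hl0.le
    refine (le_abs_self _).trans ((Complex.abs_re_le_norm _).trans ?_)
    rw [norm_mul, hw, one_mul]
    exact norm_blockSum_le (fun n => (norm_unitRMF X n ω).le) N k t
  have hint : Integrable
      (fun ω => A.indicator 1 ω * Real.exp (l * (w * randomBlock X N k t ω).re)) μ := by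
    refine Integrable.of_bound (Measurable.aestronglyMeasurable ?_) _ (Eventually.of_forall hbound)
    exact (measurable_const.indicator hAm).mul (Real.measurable_exp.comp
      ((Complex.measurable_re.comp ((h.measurable_randomBlock N k t).const_mul w)).const_mul l))
  have hle : μ.real (A ∩ {ω | δ ≤ (w * randomBlock X N k t ω).re}) * Real.exp (l * δ) ≤
      ∫ ω, A.indicator 1 ω * Real.exp (l * (w * randomBlock X N k t ω).re) ∂μ := by
    rw [← integral_indicator_one (hAm.inter hE), ← integral_mul_const]
    refine integral_mono_of_nonneg (Eventually.of_forall fun ω => mul_nonneg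
      (Set.indicator_nonneg (fun _ _ => zero_le_one) _) (Real.exp_nonneg _)) hint
      (Eventually.of_forall fun ω => ?_)
    by_cases hω : ω ∈ A ∩ {ω | δ ≤ (w * randomBlock X N k t ω).re}
    · have h2 : δ ≤ (w * randomBlock X N k t ω).re := hω.2
      simp only [Set.indicator_of_mem hω, Set.indicator_of_mem hω.1, Pi.one_apply, one_mul]
      exact Real.exp_le_exp.2 (mul_le_mul_of_nonneg_left h2 hl0.le)
    · simp only [Set.indicator_of_notMem hω, zero_mul]
      exact mul_nonneg (Set.indicator_nonneg (fun _ _ => zero_le_one) _) (Real.exp_nonneg _)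
  have hfin : μ.real (A ∩ {ω | δ ≤ (w * randomBlock X N k t ω).re}) ≤
      Real.exp (-(δ ^ 2 / (2 * V))) * μ.real A := by
    have h1 := hle.trans hmgf
    have h2 : Real.exp (l ^ 2 / 2 * ∑ p ∈ Finset.Ioc N k, incrementBound p ^ 2) ≤
        Real.exp (-(δ ^ 2 / (2 * V))) * Real.exp (l * δ) := by
      rw [← Real.exp_add, Real.exp_le_exp]
      calc _ ≤ l ^ 2 / 2 * V := mul_le_mul_of_nonneg_left hVs (by positivity)
        _ = _ := by rw [hl]; field_simp; ring
    have h3 := mul_le_mul_of_nonneg_left h2 (measureReal_nonneg (μ := μ) (s := A))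
    refine le_of_mul_le_mul_right ?_ (Real.exp_pos (l * δ))
    linarith
  rw [← ofReal_measureReal (μ := μ) (s := A ∩ _), ← ofReal_measureReal (μ := μ) (s := A),
    ← ENNReal.ofReal_mul (Real.exp_nonneg _)]
  exact ENNReal.ofReal_le_ofReal hfin

lemma measure_lt_norm_randomBlock_le (h : IsSteinhausRMF X μ) {N k : ℕ} (hN : 1 ≤ N) (hk : N ≤ k)
    (t : ℝ) {A : Set Ω} (hA : MeasurableSet[primeSigma X N] A) {V δ : ℝ}
    (hV : 0 < V) (hVs : ∑ p ∈ Finset.Ioc N k, incrementBound p ^ 2 ≤ V) (hδ : 0 < δ) :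
    μ (A ∩ {ω | 2 * δ < ‖randomBlock X N k t ω‖}) ≤
      ENNReal.ofReal (4 * Real.exp (-(δ ^ 2 / (2 * V)))) * μ A := by
  have key := fun (w : ℂ) (hw : ‖w‖ = 1) => h.measure_le_re_randomBlock_le hN hk t hA hw hV hVs hδ
  set E : ℂ → Set Ω := fun w => A ∩ {ω | δ ≤ (w * randomBlock X N k t ω).re} with hE
  have hsub : A ∩ {ω | 2 * δ < ‖randomBlock X N k t ω‖} ⊆
      (E 1 ∪ E (-1)) ∪ (E Complex.I ∪ E (-Complex.I)) := by
    rintro ω ⟨hωA, hω⟩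
    have hω : 2 * δ < ‖randomBlock X N k t ω‖ := hω
    have h1 := Complex.norm_le_abs_re_add_abs_im (randomBlock X N k t ω)
    set z := randomBlock X N k t ω
    have h2 : δ ≤ |z.re| ∨ δ ≤ |z.im| := by
      by_contra! h3
      linarith
    rcases h2 with h2 | h2 <;> rcases le_abs'.1 h2 with h3 | h3
    · exact Or.inl (Or.inr ⟨hωA, by change δ ≤ (-1 * z).re; simp; linarith⟩)
    · exact Or.inl (Or.inl ⟨hωA, by change δ ≤ (1 * z).re; simp; linarith⟩)
    · exact Or.inr (Or.inl ⟨hωA, by change δ ≤ (Complex.I * z).re; simp; linarith⟩)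
    · exact Or.inr (Or.inr ⟨hωA, by change δ ≤ (-Complex.I * z).re; simp; linarith⟩)
  set r := ENNReal.ofReal (Real.exp (-(δ ^ 2 / (2 * V))))
  calc _ ≤ μ ((E 1 ∪ E (-1)) ∪ (E Complex.I ∪ E (-Complex.I))) := measure_mono hsub
    _ ≤ (μ (E 1) + μ (E (-1))) + (μ (E Complex.I) + μ (E (-Complex.I))) :=
        (measure_union_le _ _).trans (add_le_add (measure_union_le _ _) (measure_union_le _ _))
    _ ≤ (r * μ A + r * μ A) + (r * μ A + r * μ A) := by
        gcongr <;> exact key _ (by simp)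
    _ = _ := by
        rw [ENNReal.ofReal_mul (by norm_num), ENNReal.ofReal_ofNat]
        ring

end IsSteinhausRMF

end FixedArgument

/-! ### Uniform bounds over dyadic ranges of primes -/

section Dyadic

lemma eventually_union_bound {c : ℝ} (hc : 0 < c) :
    ∀ᶠ x : ℝ in atTop, 12 * x * Real.exp (3 * Real.log (2 * x) ^ 2) *
      Real.exp (-(c * x ^ (3 / 5 : ℝ))) ≤ Real.exp (-x ^ (1 / 2 : ℝ)) := by
  have h1 := (isLittleO_log_rpow_atTop (r := 3 / 5) (by norm_num)).bound
    (show 0 < c / 4 by positivity)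
  have h2 := (isLittleO_log_rpow_rpow_atTop (s := 3 / 5) 2 (by norm_num)).bound
    (show 0 < c / 48 by positivity)
  have h3 := (tendsto_rpow_atTop (show (0 : ℝ) < 1 / 10 by norm_num)).eventually_ge_atTop (4 / c)
  filter_upwards [h1, h2, h3, eventually_ge_atTop 12] with x h1 h2 h3 hx
  have hx0 : 0 < x := by linarith
  have hl : 0 ≤ Real.log x := Real.log_nonneg (by linarith)
  rw [Real.norm_of_nonneg hl, Real.norm_of_nonneg (by positivity)] at h1
  rw [Real.rpow_two, Real.norm_of_nonneg (by positivity), Real.norm_of_nonneg (by positivity)] at h2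
  have h3' : x ^ (1 / 2 : ℝ) ≤ c / 4 * x ^ (3 / 5 : ℝ) := by
    have h4 : x ^ (3 / 5 : ℝ) = x ^ (1 / 10 : ℝ) * x ^ (1 / 2 : ℝ) := by
      rw [← Real.rpow_add hx0]
      norm_num
    rw [div_le_iff₀ hc] at h3
    rw [h4]
    have h5 : 0 < x ^ (1 / 2 : ℝ) := by positivity
    nlinarith
  have h12 : 12 * x ≤ Real.exp (Real.log x + Real.log x) := by
    rw [Real.exp_add, Real.exp_log hx0]
    gcongr
  have hlog2 : Real.log (2 * x) ≤ 2 * Real.log x := by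
    rw [Real.log_mul (by norm_num) hx0.ne']
    linarith [Real.log_le_log two_pos (show 2 ≤ x by linarith)]
  have hlog0 : 0 ≤ Real.log (2 * x) := Real.log_nonneg (by linarith)
  have hsq : Real.log (2 * x) ^ 2 ≤ 4 * Real.log x ^ 2 := by nlinarith
  calc _ ≤ Real.exp (Real.log x + Real.log x) * Real.exp (3 * Real.log (2 * x) ^ 2) *
        Real.exp (-(c * x ^ (3 / 5 : ℝ))) := by gcongr
    _ = Real.exp (Real.log x + Real.log x + 3 * Real.log (2 * x) ^ 2 +
          -(c * x ^ (3 / 5 : ℝ))) := by rw [← Real.exp_add, ← Real.exp_add]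
    _ ≤ _ := Real.exp_le_exp.2 (by linarith)

lemma sum_incrementBound_sq_le {C : ℝ}
    (hC : ∀ k : ℕ, 1 ≤ k → smoothSum 1 k ≤ C * (k : ℝ) ^ (1 / 10 : ℝ))
    {N k : ℕ} (hN : 1 ≤ N) (hk : k ≤ 2 * N) :
    ∑ p ∈ Finset.Ioc N k, incrementBound p ^ 2 ≤ 16 * C ^ 2 * (N : ℝ) ^ (-(4 / 5) : ℝ) := by
  have hN0 : (0 : ℝ) < N := by exact_mod_cast hN
  have hterm : ∀ p ∈ Finset.Ioc N k,
      incrementBound p ^ 2 ≤ 16 * C ^ 2 * (N : ℝ) ^ (-(9 / 5) : ℝ) := by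
    intro p hp
    have hNp := (Finset.mem_Ioc.1 hp).1
    have hp0 : (0 : ℝ) < p := by exact_mod_cast (by omega : 0 < p)
    have h0 : 0 ≤ incrementBound p :=
      div_nonneg (mul_nonneg (by norm_num) (smoothSum_nonneg one_pos p)) hp0.le
    have h1 : incrementBound p ≤ 4 * C * (p : ℝ) ^ (-(9 / 10) : ℝ) := by
      rw [incrementBound, div_le_iff₀ hp0]
      have h3 := hC p (by omega)
      have : (p : ℝ) ^ (-(9 / 10) : ℝ) * p = (p : ℝ) ^ (1 / 10 : ℝ) := by
        rw [← Real.rpow_add_one hp0.ne']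
        norm_num
      rw [mul_assoc, this]
      linarith
    calc incrementBound p ^ 2 ≤ (4 * C * (p : ℝ) ^ (-(9 / 10) : ℝ)) ^ 2 := by gcongr
      _ = 16 * C ^ 2 * (p : ℝ) ^ (-(9 / 5) : ℝ) := by
          rw [mul_pow, mul_pow, ← Real.rpow_mul_natCast hp0.le]
          norm_num
      _ ≤ _ := by
          refine mul_le_mul_of_nonneg_left ?_ (by positivity)
          exact Real.rpow_le_rpow_of_nonpos hN0 (by exact_mod_cast hNp.le) (by norm_num)
  refine (Finset.sum_le_card_nsmul _ _ _ hterm).trans ?_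
  have hcard : ((Finset.Ioc N k).card : ℝ) ≤ N := by
    rw [Nat.card_Ioc]
    exact_mod_cast (by omega : k - N ≤ N)
  rw [nsmul_eq_mul]
  calc _ ≤ (N : ℝ) * (16 * C ^ 2 * (N : ℝ) ^ (-(9 / 5) : ℝ)) := by gcongr
    _ = 16 * C ^ 2 * ((N : ℝ) ^ (-(9 / 5) : ℝ) * N) := by ring
    _ = _ := by
        rw [← Real.rpow_add_one hN0.ne']
        norm_num

variable {Ω : Type*}

/-- The event that, for some `k ∈ (N, 2N]`, the block of the primes in `(N, k]` exceeds
`2 N^{-1/10}` somewhere on `[0, 1]`. -/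
def badEvent (X : ℤ → Ω → ℂ) (N : ℕ) : Set Ω :=
  {ω | ∃ k, N < k ∧ k ≤ 2 * N ∧ ∃ t ∈ Set.Icc (0 : ℝ) 1,
    2 * (N : ℝ) ^ (-(1 / 10) : ℝ) < ‖randomBlock X N k t ω‖}

/-- The number of mesh points used to discretise `[0, 1]` for the block `(N, 2N]`: it is large
enough for the Hölder bound with exponent `1 / (3 log (2N))` to gain a factor `2N`. -/
noncomputable def gridSize (N : ℕ) : ℕ := ⌈Real.exp (3 * Real.log (2 * N) ^ 2)⌉₊

lemma gridSize_pos (N : ℕ) : 0 < gridSize N := Nat.ceil_pos.2 (Real.exp_pos _)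

lemma one_div_gridSize_rpow_le {N : ℕ} (hN : 1 ≤ N) :
    (1 / (gridSize N : ℝ)) ^ (1 / (3 * Real.log (2 * N : ℕ))) ≤ 1 / (2 * N) := by
  have hN1 : (1 : ℝ) ≤ N := by exact_mod_cast hN
  have hl : 0 < Real.log (2 * N) := Real.log_pos (by linarith)
  have h1 : 1 / (gridSize N : ℝ) ≤ Real.exp (-(3 * Real.log (2 * N) ^ 2)) := by
    rw [Real.exp_neg, ← one_div]
    exact one_div_le_one_div_of_le (Real.exp_pos _) (Nat.le_ceil _)
  push_cast
  refine (Real.rpow_le_rpow (by positivity) h1 (by positivity)).trans ?_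
  rw [← Real.exp_mul]
  have : -(3 * Real.log (2 * N) ^ 2) * (1 / (3 * Real.log (2 * N))) = -Real.log (2 * N) := by
    field_simp
  rw [this, Real.exp_neg, Real.exp_log (by positivity), one_div]

lemma exists_grid_point {G : ℕ} (hG : 0 < G) {t : ℝ} (ht : t ∈ Set.Icc (0 : ℝ) 1) :
    ∃ j ∈ Finset.range (G + 1), |t - j / G| ≤ 1 / G := by
  have hG0 : (0 : ℝ) < G := by exact_mod_cast hG
  refine ⟨⌊t * G⌋₊, ?_, ?_⟩
  · rw [Finset.mem_range, Nat.lt_succ_iff]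
    refine Nat.floor_le_of_le ?_
    nlinarith [ht.2]
  · have h0 : 0 ≤ t * G := mul_nonneg ht.1 hG0.le
    have h1 := Nat.floor_le h0
    have h2 := Nat.lt_floor_add_one (t * G)
    rw [show t - (⌊t * G⌋₊ : ℝ) / G = (t * G - ⌊t * G⌋₊) / G by field_simp, abs_div,
      abs_of_nonneg (by linarith), abs_of_pos hG0]
    gcongr
    linarith

/-- Off the grid, the block moves by at most `N^{-1/10}`. -/
lemma badEvent_subset {C : ℝ} (hC : ∀ k : ℕ, 1 ≤ k → smoothSum 1 k ≤ C * (k : ℝ) ^ (1 / 10 : ℝ))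
    (X : ℤ → Ω → ℂ) {N : ℕ} (hN : 1 ≤ N)
    (hNC : 8 * Real.pi * C ^ 2 ≤ (N : ℝ) ^ (7 / 10 : ℝ)) :
    badEvent X N ⊆ ⋃ k ∈ Finset.Ioc N (2 * N), ⋃ j ∈ Finset.range (gridSize N + 1),
      {ω | 2 * ((N : ℝ) ^ (-(1 / 10) : ℝ) / 2) <
        ‖randomBlock X N k ((j : ℝ) / gridSize N) ω‖} := by
  rintro ω ⟨k, hk1, hk2, t, ht, hω⟩
  have hN0 : (0 : ℝ) < N := by exact_mod_cast hN
  obtain ⟨j, hj, hjt⟩ := exists_grid_point (gridSize_pos N) ht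
  simp only [Set.mem_iUnion]
  refine ⟨k, Finset.mem_Ioc.2 ⟨hk1, hk2⟩, j, hj, ?_⟩
  change 2 * ((N : ℝ) ^ (-(1 / 10) : ℝ) / 2) < ‖randomBlock X N k ((j : ℝ) / gridSize N) ω‖
  have hH := norm_blockSum_sub_le (f := fun n => unitRMF X n ω) (N := N)
    (fun n => (norm_unitRMF X n ω).le) (by omega : 2 ≤ 2 * N) hk2 ((j : ℝ) / gridSize N) t
  have h1 : |t - (j : ℝ) / gridSize N| ^ (1 / (3 * Real.log (2 * N : ℕ))) ≤ 1 / (2 * N) := by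
    refine (Real.rpow_le_rpow (abs_nonneg _) hjt ?_).trans (one_div_gridSize_rpow_le hN)
    have : 0 ≤ Real.log (2 * N : ℕ) := Real.log_natCast_nonneg _
    positivity
  have h2 : smoothSum 1 (2 * N) ^ 2 ≤ C ^ 2 * (2 * (N : ℝ) ^ (1 / 5 : ℝ)) := by
    have h3 := hC (2 * N) (by omega)
    calc smoothSum 1 (2 * N) ^ 2 ≤ (C * ((2 * N : ℕ) : ℝ) ^ (1 / 10 : ℝ)) ^ 2 :=
          pow_le_pow_left₀ (smoothSum_nonneg one_pos _) h3 2
      _ = C ^ 2 * (2 * N : ℝ) ^ (1 / 5 : ℝ) := by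
          rw [mul_pow, ← Real.rpow_mul_natCast (by positivity)]
          norm_num
      _ ≤ _ := by
          rw [Real.mul_rpow (by norm_num) hN0.le]
          gcongr
          exact Real.rpow_le_self_of_one_le (by norm_num) (by norm_num)
  have h3 : ‖randomBlock X N k t ω - randomBlock X N k ((j : ℝ) / gridSize N) ω‖ ≤
      (N : ℝ) ^ (-(1 / 10) : ℝ) := by
    refine hH.trans ?_
    calc _ ≤ 4 * Real.pi * (1 / (2 * N)) * (C ^ 2 * (2 * (N : ℝ) ^ (1 / 5 : ℝ))) := by gcongr
      _ = (4 * Real.pi * C ^ 2) * ((N : ℝ) ^ (1 / 5 : ℝ) * (N : ℝ) ^ (-1 : ℝ)) := by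
          rw [Real.rpow_neg_one]
          field_simp
      _ ≤ (N : ℝ) ^ (7 / 10 : ℝ) * ((N : ℝ) ^ (1 / 5 : ℝ) * (N : ℝ) ^ (-1 : ℝ)) := by
          gcongr
          nlinarith [Real.pi_pos, sq_nonneg C]
      _ = _ := by
          rw [← Real.rpow_add hN0, ← Real.rpow_add hN0]
          norm_num
  have h4 := norm_sub_norm_le (randomBlock X N k t ω) (randomBlock X N k ((j : ℝ) / gridSize N) ω)
  linarith

/-- Union bound over `k` and over the grid: conditionally on the primes up to `N`, bad events have
probability at most `exp(-√N)`. -/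
lemma exists_measure_badEvent_le : ∃ N₀ : ℕ, 1 ≤ N₀ ∧ ∀ {Ω : Type*} [MeasurableSpace Ω]
    (μ : Measure Ω) [IsProbabilityMeasure μ] (X : ℤ → Ω → ℂ), IsSteinhausRMF X μ →
    ∀ N : ℕ, N₀ ≤ N → ∀ A : Set Ω, MeasurableSet[primeSigma X N] A →
      μ (A ∩ badEvent X N) ≤ ENNReal.ofReal (Real.exp (-(N : ℝ) ^ (1 / 2 : ℝ))) * μ A := by
  obtain ⟨C, hC1, hC⟩ := smoothSum_one_le
  have hev := (eventually_union_bound (show 0 < 1 / (128 * C ^ 2) by positivity)).and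
    ((tendsto_rpow_atTop (show (0 : ℝ) < 7 / 10 by norm_num)).eventually_ge_atTop
      (8 * Real.pi * C ^ 2))
  obtain ⟨N₀, hN₀⟩ := eventually_atTop.1 (tendsto_natCast_atTop_atTop.eventually hev)
  refine ⟨max 1 N₀, le_max_left _ _, fun {Ω} _ μ _ X h N hN A hA => ?_⟩
  obtain ⟨hb1, hb2⟩ := hN₀ N ((le_max_right _ _).trans hN)
  have hN1 : 1 ≤ N := (le_max_left _ _).trans hN
  have hN0 : (0 : ℝ) < N := by exact_mod_cast hN1
  set δ := (N : ℝ) ^ (-(1 / 10) : ℝ) / 2 with hδ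
  set V := 16 * C ^ 2 * (N : ℝ) ^ (-(4 / 5) : ℝ) with hV
  have hexp : δ ^ 2 / (2 * V) = 1 / (128 * C ^ 2) * (N : ℝ) ^ (3 / 5 : ℝ) := by
    have h1 : ((N : ℝ) ^ (-(1 / 10) : ℝ)) ^ 2 =
        (N : ℝ) ^ (3 / 5 : ℝ) * (N : ℝ) ^ (-(4 / 5) : ℝ) := by
      rw [← Real.rpow_mul_natCast hN0.le, ← Real.rpow_add hN0]
      norm_num
    have h2 : (0 : ℝ) < (N : ℝ) ^ (-(4 / 5) : ℝ) := by positivity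
    rw [hδ, hV, div_pow, h1]
    field_simp
    norm_num
  set r := Real.exp (-(1 / (128 * C ^ 2) * (N : ℝ) ^ (3 / 5 : ℝ))) with hr
  have hpt : ∀ k ∈ Finset.Ioc N (2 * N), ∀ t : ℝ,
      μ (A ∩ {ω | 2 * δ < ‖randomBlock X N k t ω‖}) ≤ ENNReal.ofReal (4 * r) * μ A := by
    intro k hk t
    rw [Finset.mem_Ioc] at hk
    rw [hr, ← hexp]
    exact h.measure_lt_norm_randomBlock_le hN1 hk.1.le t hA (by positivity)
      (sum_incrementBound_sq_le hC hN1 hk.2) (by positivity)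
  have hG : ((gridSize N + 1 : ℕ) : ℝ) ≤ 3 * Real.exp (3 * Real.log (2 * N) ^ 2) := by
    have h1 := (Nat.ceil_lt_add_one (Real.exp_nonneg (3 * Real.log (2 * N) ^ 2))).le
    have h2 : 1 ≤ Real.exp (3 * Real.log (2 * N) ^ 2) := Real.one_le_exp (by positivity)
    have h3 : (gridSize N : ℝ) ≤ Real.exp (3 * Real.log (2 * N) ^ 2) + 1 := h1
    push_cast
    linarith
  calc μ (A ∩ badEvent X N)
      ≤ μ (⋃ k ∈ Finset.Ioc N (2 * N), ⋃ j ∈ Finset.range (gridSize N + 1),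
          A ∩ {ω | 2 * δ < ‖randomBlock X N k ((j : ℝ) / gridSize N) ω‖}) := by
        refine measure_mono ((Set.inter_subset_inter_right A
          (badEvent_subset hC X hN1 hb2)).trans ?_)
        simp only [Set.inter_iUnion]
        exact subset_rfl
    _ ≤ ∑ k ∈ Finset.Ioc N (2 * N), ∑ j ∈ Finset.range (gridSize N + 1),
          ENNReal.ofReal (4 * r) * μ A := by
        refine (measure_biUnion_finset_le _ _).trans (Finset.sum_le_sum fun k hk => ?_)
        exact (measure_biUnion_finset_le _ _).trans (Finset.sum_le_sum fun j _ => hpt k hk _)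
    _ = ENNReal.ofReal (N * ((gridSize N + 1 : ℕ) * (4 * r))) * μ A := by
        rw [Finset.sum_const, Finset.sum_const, Nat.card_Ioc, Finset.card_range, nsmul_eq_mul,
          nsmul_eq_mul, ENNReal.ofReal_mul hN0.le, ENNReal.ofReal_natCast,
          ENNReal.ofReal_mul (Nat.cast_nonneg _), ENNReal.ofReal_natCast,
          show 2 * N - N = N by omega]
        ring
    _ ≤ _ := by
        gcongr
        refine le_trans ?_ hb1
        calc _ ≤ (N : ℝ) * (3 * Real.exp (3 * Real.log (2 * N) ^ 2) * (4 * r)) := by gcongr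
          _ = _ := by ring

end Dyadic

/-! ### Summing over dyadic ranges -/

section Tail

variable {Ω : Type*}

/-- Some dyadic range of primes above `N` is bad. -/
def badTail (X : ℤ → Ω → ℂ) (N : ℕ) : Set Ω := ⋃ j : ℕ, badEvent X (2 ^ j * N)

/-- `2 ∑_j 2^{-j/10}`, the constant in the sum of the bounds `2 (2^j N)^{-1/10}`. -/
noncomputable def tailConst : ℝ := 2 * (1 - (2 : ℝ) ^ (-(1 / 10) : ℝ))⁻¹

lemma two_rpow_lt_one : (2 : ℝ) ^ (-(1 / 10) : ℝ) < 1 :=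
  Real.rpow_lt_one_of_one_lt_of_neg one_lt_two (by norm_num)

lemma tailConst_pos : 0 < tailConst :=
  mul_pos two_pos (inv_pos.2 (sub_pos.2 two_rpow_lt_one))

lemma randomBlock_add (X : ℤ → Ω → ℂ) {N k l : ℕ} (h1 : N ≤ k) (h2 : k ≤ l) (t : ℝ) (ω : Ω) :
    randomBlock X N k t ω + randomBlock X k l t ω = randomBlock X N l t ω :=
  blockSum_add (fun n => (norm_unitRMF X n ω).le) h1 h2 t

lemma norm_randomBlock_le_of_notMem {X : ℤ → Ω → ℂ} {N : ℕ} (hN : 1 ≤ N) {ω : Ω}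
    (hω : ω ∉ badTail X N) {k : ℕ} (hk : N ≤ k) {t : ℝ} (ht : t ∈ Set.Icc (0 : ℝ) 1) :
    ‖randomBlock X N k t ω‖ ≤ tailConst * (N : ℝ) ^ (-(1 / 10) : ℝ) := by
  set q := (2 : ℝ) ^ (-(1 / 10) : ℝ) with hq
  have hq0 : 0 < q := by positivity
  have hstep : ∀ j l : ℕ, 2 ^ j * N ≤ l → l ≤ 2 * (2 ^ j * N) →
      ‖randomBlock X (2 ^ j * N) l t ω‖ ≤ 2 * (N : ℝ) ^ (-(1 / 10) : ℝ) * q ^ j := by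
    intro j l h1 h2
    rcases h1.eq_or_lt with rfl | h1
    · rw [randomBlock, blockSum_self, norm_zero]
      positivity
    · by_contra! h3
      refine hω (Set.mem_iUnion.2 ⟨j, l, h1, h2, t, ht, ?_⟩)
      refine lt_of_eq_of_lt ?_ h3
      push_cast
      rw [Real.mul_rpow (by positivity) (by positivity), hq, Real.rpow_pow_comm zero_le_two]
      ring
  have hpow : ∀ j : ℕ, ‖randomBlock X N (2 ^ j * N) t ω‖ ≤
      2 * (N : ℝ) ^ (-(1 / 10) : ℝ) * ∑ i ∈ Finset.range j, q ^ i := by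
    intro j
    induction j with
    | zero => simp [randomBlock, blockSum_self]
    | succ j ih =>
      have h1 : N ≤ 2 ^ j * N := Nat.le_mul_of_pos_left _ (by positivity)
      have h2 : 2 ^ j * N ≤ 2 ^ (j + 1) * N :=
        Nat.mul_le_mul_right _ (Nat.pow_le_pow_right two_pos (by omega))
      rw [← randomBlock_add X h1 h2, Finset.sum_range_succ, mul_add]
      refine (norm_add_le _ _).trans (add_le_add ih (hstep j _ h2 ?_))
      rw [pow_succ]
      exact le_of_eq (by ring)
  obtain ⟨j, hj1, hj2⟩ : ∃ j, 2 ^ j * N ≤ k ∧ k ≤ 2 * (2 ^ j * N) := by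
    have hkN : k / N ≠ 0 := (Nat.div_pos hk hN).ne'
    refine ⟨Nat.log 2 (k / N), ?_, ?_⟩
    · exact (Nat.mul_le_mul_right _ (Nat.pow_log_le_self 2 hkN)).trans (Nat.div_mul_le_self k N)
    · have h1 := Nat.lt_pow_succ_log_self one_lt_two (k / N)
      have h2 := (Nat.div_lt_iff_lt_mul hN).1 h1
      rw [pow_succ] at h2
      linarith
  have h1 : N ≤ 2 ^ j * N := Nat.le_mul_of_pos_left _ (by positivity)
  rw [← randomBlock_add X h1 hj1]
  refine (norm_add_le _ _).trans ((add_le_add (hpow j) (hstep j k hj1 hj2)).trans ?_)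
  rw [← mul_add, ← Finset.sum_range_succ]
  have hgeom : ∑ i ∈ Finset.range (j + 1), q ^ i ≤ (1 - q)⁻¹ := by
    rw [← tsum_geometric_of_lt_one hq0.le two_rpow_lt_one]
    exact (summable_geometric_of_lt_one hq0.le two_rpow_lt_one).sum_le_tsum _
      fun i _ => by positivity
  calc _ ≤ 2 * (N : ℝ) ^ (-(1 / 10) : ℝ) * (1 - q)⁻¹ := by gcongr
    _ = _ := by rw [tailConst]; ring

end Tail

lemma sqrt_add_le_rpow_two_pow_mul {N : ℕ} (hN : 1 ≤ N) (j : ℕ) :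
    (N : ℝ) ^ (1 / 2 : ℝ) + j * (1 / 4) ≤ ((2 ^ j * N : ℕ) : ℝ) ^ (1 / 2 : ℝ) := by
  have hN1 : 1 ≤ (N : ℝ) ^ (1 / 2 : ℝ) :=
    Real.one_le_rpow (by exact_mod_cast hN) (by norm_num)
  have h2 : (5 / 4 : ℝ) ≤ (2 : ℝ) ^ (1 / 2 : ℝ) := by
    rw [← Real.sqrt_eq_rpow]
    exact Real.le_sqrt_of_sq_le (by norm_num)
  have h3 : 1 + (j : ℝ) * (1 / 4) ≤ ((2 : ℝ) ^ (1 / 2 : ℝ)) ^ j := by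
    refine (one_add_mul_le_pow (a := 1 / 4) (by norm_num) j).trans ?_
    gcongr
    linarith
  push_cast
  rw [Real.mul_rpow (by positivity) (by positivity), ← Real.rpow_pow_comm zero_le_two]
  have h4 : (0 : ℝ) ≤ j * (1 / 4) := by positivity
  nlinarith

/-- `∑_j e^{-j/4}`. -/
noncomputable def probConst : ℝ := (1 - Real.exp (-(1 / 4)))⁻¹

lemma one_le_probConst : 1 ≤ probConst := by
  have h1 : Real.exp (-(1 / 4)) < 1 := Real.exp_lt_one_iff.2 (by norm_num)
  have h2 := Real.exp_pos (-(1 / 4))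
  exact (one_le_inv₀ (by linarith)).2 (by linarith)

lemma exists_measure_badTail_le : ∃ N₀ : ℕ, 1 ≤ N₀ ∧ ∀ {Ω : Type*} [MeasurableSpace Ω]
    (μ : Measure Ω) [IsProbabilityMeasure μ] (X : ℤ → Ω → ℂ), IsSteinhausRMF X μ →
    ∀ N : ℕ, N₀ ≤ N → ∀ A : Set Ω, MeasurableSet[primeSigma X N] A →
      μ (A ∩ badTail X N) ≤
        ENNReal.ofReal (probConst * Real.exp (-(N : ℝ) ^ (1 / 2 : ℝ))) * μ A := by
  obtain ⟨N₀, h1, hN₀⟩ := exists_measure_badEvent_le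
  refine ⟨N₀, h1, fun {Ω} _ μ _ X h N hN A hA => ?_⟩
  have hq : Real.exp (-(1 / 4)) < 1 := Real.exp_lt_one_iff.2 (by norm_num)
  have hj : ∀ j : ℕ, N ≤ 2 ^ j * N := fun j => Nat.le_mul_of_pos_left _ (by positivity)
  calc μ (A ∩ badTail X N) ≤ ∑' j : ℕ, μ (A ∩ badEvent X (2 ^ j * N)) := by
        rw [badTail, Set.inter_iUnion]
        exact measure_iUnion_le _
    _ ≤ ∑' j : ℕ, ENNReal.ofReal (Real.exp (-(N : ℝ) ^ (1 / 2 : ℝ)) *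
          Real.exp (-(1 / 4)) ^ j) * μ A := by
        refine ENNReal.tsum_le_tsum fun j => ?_
        refine (hN₀ μ X h _ (hN.trans (hj j)) A (primeSigma_mono X (hj j) A hA)).trans ?_
        gcongr
        rw [← Real.exp_nat_mul, ← Real.exp_add, Real.exp_le_exp]
        linarith [sqrt_add_le_rpow_two_pow_mul (h1.trans hN) j]
    _ = _ := by
        rw [ENNReal.tsum_mul_right, ← ENNReal.ofReal_tsum_of_nonneg (fun j => by positivity)
          ((summable_geometric_of_lt_one (Real.exp_nonneg _) hq).mul_left _), tsum_mul_left,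
          tsum_geometric_of_lt_one (Real.exp_nonneg _) hq, mul_comm (Real.exp _), probConst]

lemma tendsto_probConst_mul_exp : Tendsto
    (fun N : ℕ => ENNReal.ofReal (probConst * Real.exp (-(N : ℝ) ^ (1 / 2 : ℝ)))) atTop (𝓝 0) := by
  have h1 : Tendsto (fun N : ℕ => (N : ℝ) ^ (1 / 2 : ℝ)) atTop atTop :=
    (tendsto_rpow_atTop (by norm_num)).comp tendsto_natCast_atTop_atTop
  have h2 := ((Real.tendsto_exp_neg_atTop_nhds_zero.comp h1).const_mul probConst)
  rw [mul_zero] at h2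
  simpa using ENNReal.tendsto_ofReal h2

/-! ### The rough part -/

section Rough

variable {Ω : Type*} {X : ℤ → Ω → ℂ}

lemma truncatedRoughPart_eq {ω : Ω} (hω : ∀ n : ℤ, n ≠ 0 → unitRMF X n ω = X n ω) {y : ℝ}
    (hy : 0 ≤ y) (z t : ℝ) :
    truncatedRoughPart X y z ω t = randomBlock X ⌊y⌋₊ ⌊z⌋₊ t ω := by
  have hset : {n : ℤ | n ≠ 0 ∧ y < (largestPrimeFactor n.natAbs : ℝ) ∧
      (largestPrimeFactor n.natAbs : ℝ) ≤ z} = block ⌊y⌋₊ ⌊z⌋₊ := by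
    ext n
    have h1 : largestPrimeFactor n.natAbs ≠ 0 :=
      (Nat.lt_of_lt_of_le one_pos (one_le_largestPrimeFactor _)).ne'
    change _ ∧ _ ∧ _ ↔ _ ∧ _ ∧ _
    rw [Nat.floor_lt hy, Nat.le_floor_iff' h1]
  rw [truncatedRoughPart, randomBlock, blockSum]
  refine (tsum_subtype {n : ℤ | n ≠ 0 ∧ y < (largestPrimeFactor n.natAbs : ℝ) ∧
      (largestPrimeFactor n.natAbs : ℝ) ≤ z}
      (fun n : ℤ => (1 - e (n * t)) / (n : ℂ) * X n ω)).trans ?_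
  rw [hset]
  refine tsum_congr fun n => ?_
  by_cases h : n ∈ block ⌊y⌋₊ ⌊z⌋₊
  · rw [Set.indicator_of_mem h, Set.indicator_of_mem h, hω n h.1]
  · rw [Set.indicator_of_notMem h, Set.indicator_of_notMem h]

lemma smoothPart_eq {ω : Ω} (hω : ∀ n : ℤ, n ≠ 0 → unitRMF X n ω = X n ω) (y t : ℝ) :
    smoothPart X y ω t = randomBlock X 0 ⌊y⌋₊ t ω := by
  have hset : {n : ℤ | n ≠ 0 ∧ (largestPrimeFactor n.natAbs : ℝ) ≤ y} = block 0 ⌊y⌋₊ := by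
    ext n
    have h1 : largestPrimeFactor n.natAbs ≠ 0 :=
      (Nat.lt_of_lt_of_le one_pos (one_le_largestPrimeFactor _)).ne'
    change _ ∧ _ ↔ _ ∧ _ ∧ _
    rw [Nat.le_floor_iff' h1]
    simp [Nat.pos_of_ne_zero h1]
  rw [smoothPart, randomBlock, blockSum]
  refine (tsum_subtype {n : ℤ | n ≠ 0 ∧ (largestPrimeFactor n.natAbs : ℝ) ≤ y}
      (fun n : ℤ => (1 - e (n * t)) / (n : ℂ) * X n ω)).trans ?_
  rw [hset]
  refine tsum_congr fun n => ?_
  by_cases h : n ∈ block 0 ⌊y⌋₊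
  · rw [Set.indicator_of_mem h, Set.indicator_of_mem h, hω n h.1]
  · rw [Set.indicator_of_notMem h, Set.indicator_of_notMem h]

lemma tendsto_tailConst_mul :
    Tendsto (fun N : ℕ => tailConst * (N : ℝ) ^ (-(1 / 10) : ℝ)) atTop (𝓝 0) := by
  have h1 := (tendsto_rpow_neg_atTop (show (0 : ℝ) < 1 / 10 by norm_num)).comp
    tendsto_natCast_atTop_atTop
  simpa using h1.const_mul tailConst

/-- If arbitrarily large `N` have no bad dyadic range above them, the truncations are uniformly
Cauchy. -/
lemma tendstoUniformlyOn_roughPart {ω : Ω} (hω : ∀ n : ℤ, n ≠ 0 → unitRMF X n ω = X n ω)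
    (hbad : ∀ N₁ : ℕ, ∃ N ≥ N₁, ω ∉ badTail X N) {y : ℝ} (hy : 1 < y) :
    TendstoUniformlyOn (fun (z : ℝ) (t : ℝ) => truncatedRoughPart X y z ω t)
      (roughPart X y ω) atTop (Set.Icc 0 1) := by
  have hc : UniformCauchySeqOn (fun (z : ℝ) (t : ℝ) => truncatedRoughPart X y z ω t) atTop
      (Set.Icc 0 1) := by
    rw [Metric.uniformCauchySeqOn_iff]
    intro ε hε
    obtain ⟨N₁, hN₁⟩ := eventually_atTop.1
      (tendsto_tailConst_mul.eventually_lt_const (half_pos hε))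
    obtain ⟨N, hN, hNbad⟩ := hbad (max N₁ (⌊y⌋₊ + 1))
    have hN1 : N₁ ≤ N := (le_max_left _ _).trans hN
    have hNy : ⌊y⌋₊ + 1 ≤ N := (le_max_right _ _).trans hN
    refine ⟨N, fun z hz z' hz' t ht => ?_⟩
    have hz := Nat.le_floor hz
    have hz' := Nat.le_floor hz'
    rw [truncatedRoughPart_eq hω (by linarith), truncatedRoughPart_eq hω (by linarith),
      ← randomBlock_add X (by omega : ⌊y⌋₊ ≤ N) hz, ← randomBlock_add X (by omega : ⌊y⌋₊ ≤ N) hz',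
      dist_add_left, dist_eq_norm]
    have h1 := norm_randomBlock_le_of_notMem (by omega) hNbad hz ht
    have h2 := norm_randomBlock_le_of_notMem (by omega) hNbad hz' ht
    have h3 := hN₁ N hN1
    linarith [norm_sub_le (randomBlock X N ⌊z⌋₊ t ω) (randomBlock X N ⌊z'⌋₊ t ω)]
  refine hc.tendstoUniformlyOn_of_tendsto fun t ht => ?_
  exact CauchySeq.tendsto_limUnder (hc.cauchy_map ht)

lemma supNorm_roughPart_le {ω : Ω} (hω : ∀ n : ℤ, n ≠ 0 → unitRMF X n ω = X n ω)
    {y : ℝ} (hy : 1 < y)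
    (hlim : TendstoUniformlyOn (fun (z : ℝ) (t : ℝ) => truncatedRoughPart X y z ω t)
      (roughPart X y ω) atTop (Set.Icc 0 1)) (hbad : ω ∉ badTail X ⌊y⌋₊) :
    supNorm (roughPart X y ω) ≤
      ENNReal.ofReal (tailConst * (⌊y⌋₊ : ℝ) ^ (-(1 / 10) : ℝ)) := by
  refine iSup₂_le fun t ht => ?_
  rw [← ofReal_norm]
  refine ENNReal.ofReal_le_ofReal (le_of_tendsto (hlim.tendsto_at ht).norm ?_)
  filter_upwards [eventually_ge_atTop y] with z hz
  rw [truncatedRoughPart_eq hω (by linarith)]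
  exact norm_randomBlock_le_of_notMem (Nat.le_floor (by exact_mod_cast hy.le)) hbad
    (Nat.floor_mono hz) ht

variable [MeasurableSpace Ω] {μ : Measure Ω}

/-- Up to a null set, an event determined by `S_y` is determined by `X_{-1}` and the `X_p` with
`p ≤ y`. -/
lemma IsSteinhausRMF.exists_ae_eq_primeSigma (h : IsSteinhausRMF X μ) {y : ℝ} {A : Set Ω}
    (hA : MeasurableSet[smoothSigma X y] A) :
    ∃ A' : Set Ω, MeasurableSet[primeSigma X ⌊y⌋₊] A' ∧ A =ᵐ[μ] A' := by
  obtain ⟨S, hS, rfl⟩ := hA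
  refine ⟨(fun ω (t : Set.Icc (0 : ℝ) 1) => randomBlock X 0 ⌊y⌋₊ t ω) ⁻¹' S, ?_, ?_⟩
  · have hm : Measurable[primeSigma X ⌊y⌋₊]
        fun ω (t : Set.Icc (0 : ℝ) 1) => randomBlock X 0 ⌊y⌋₊ t ω :=
      (@measurable_pi_iff _ _ _ (primeSigma X ⌊y⌋₊) _ _).2
        fun t => measurable_blockSum X 0 ⌊y⌋₊ t
    exact hm hS
  · filter_upwards [h.ae_unitRMF_eq] with ω hω
    have : (fun t : Set.Icc (0 : ℝ) 1 => smoothPart X y ω t) =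
        fun t : Set.Icc (0 : ℝ) 1 => randomBlock X 0 ⌊y⌋₊ t ω :=
      funext fun t => smoothPart_eq hω y t
    change ((fun t : Set.Icc (0 : ℝ) 1 => smoothPart X y ω t) ∈ S) = (_ ∈ S)
    rw [this]

end Rough

/-- The strong form of the tail bound: conditionally on `S_y`, `‖R_y‖_∞` exceeds a fixed multiple of
`⌊y⌋^{-1/10}` with probability `O(exp(-√⌊y⌋))`. -/
lemma exists_measure_roughEvent_le : ∃ N₀ : ℕ, ∀ {Ω : Type*} [MeasurableSpace Ω]
    (μ : Measure Ω) [IsProbabilityMeasure μ] (X : ℤ → Ω → ℂ), IsSteinhausRMF X μ →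
    (∀ᵐ ω ∂μ, ∀ y > 1, TendstoUniformlyOn
      (fun (z : ℝ) (t : ℝ) => truncatedRoughPart X y z ω t) (roughPart X y ω) atTop
      (Set.Icc 0 1)) ∧
    ∀ y : ℝ, 1 < y → N₀ ≤ ⌊y⌋₊ → ∀ ε : ℝ, tailConst * (⌊y⌋₊ : ℝ) ^ (-(1 / 10) : ℝ) ≤ ε →
      ∀ A : Set Ω, MeasurableSet[smoothSigma X y] A →
        μ (roughEvent X y ε ∩ A) ≤
          ENNReal.ofReal (probConst * Real.exp (-(⌊y⌋₊ : ℝ) ^ (1 / 2 : ℝ))) * μ A := by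
  obtain ⟨N₀, -, hN₀⟩ := exists_measure_badTail_le
  refine ⟨N₀, fun {Ω} _ μ _ X h => ?_⟩
  have hinf : ∀ᵐ ω ∂μ, ∀ N₁ : ℕ, ∃ N ≥ N₁, ω ∉ badTail X N := by
    rw [ae_all_iff]
    intro N₁
    rw [ae_iff]
    refine le_antisymm (ge_of_tendsto tendsto_probConst_mul_exp ?_) bot_le
    filter_upwards [eventually_ge_atTop (max N₀ N₁)] with N hN
    have h1 := hN₀ μ X h N ((le_max_left _ _).trans hN) Set.univ MeasurableSet.univ
    rw [measure_univ, mul_one, Set.univ_inter] at h1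
    refine (measure_mono fun ω hω => ?_).trans h1
    by_contra h2
    exact hω ⟨N, (le_max_right _ _).trans hN, h2⟩
  have hlim : ∀ᵐ ω ∂μ, ∀ y > 1, TendstoUniformlyOn
      (fun (z : ℝ) (t : ℝ) => truncatedRoughPart X y z ω t) (roughPart X y ω) atTop
      (Set.Icc 0 1) := by
    filter_upwards [h.ae_unitRMF_eq, hinf] with ω h1 h2 y hy
    exact tendstoUniformlyOn_roughPart h1 h2 hy
  refine ⟨hlim, fun y hy hyN ε hε A hA => ?_⟩
  obtain ⟨A', hA', hAA'⟩ := h.exists_ae_eq_primeSigma hA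
  rw [measure_congr hAA']
  refine le_trans (measure_mono_ae ?_) (hN₀ μ X h _ hyN A' hA')
  filter_upwards [hAA', h.ae_unitRMF_eq, hlim] with ω h1 h2 h3 h4
  refine ⟨h1.mp h4.2, ?_⟩
  by_contra h5
  have h6 := supNorm_roughPart_le h2 hy (h3 y hy) h5
  exact absurd (h6.trans (ENNReal.ofReal_le_ofReal hε)) (not_le.2 h4.1)

/-! ### Comparison with the stated bound -/

lemma eventually_rough_bounds (N₀ : ℕ) : ∀ᶠ y : ℝ in atTop,
    N₀ ≤ ⌊y⌋₊ ∧ 19 < Real.log y ∧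
      tailConst * (⌊y⌋₊ : ℝ) ^ (-(1 / 10) : ℝ) ≤ 1 / Real.log y ∧
      19 * Real.log (Real.log y) * y ^ (1 / 3 : ℝ) ≤ (⌊y⌋₊ : ℝ) ^ (1 / 2 : ℝ) := by
  have h1 := (isLittleO_log_rpow_atTop (r := 1 / 10) (by norm_num)).bound
    (show 0 < 1 / (2 * tailConst) from div_pos one_pos (mul_pos two_pos tailConst_pos))
  have h2 := (isLittleO_log_rpow_atTop (r := 1 / 6) (by norm_num)).bound
    (show (0 : ℝ) < 1 / 38 by norm_num)
  filter_upwards [h1, h2, eventually_ge_atTop 2, eventually_ge_atTop (N₀ : ℝ),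
    Real.tendsto_log_atTop.eventually_gt_atTop 19] with y h1 h2 hy hyN hlog
  have hy0 : 0 < y := by linarith
  have hl : 0 < Real.log y := by linarith
  rw [Real.norm_of_nonneg hl.le, Real.norm_of_nonneg (by positivity)] at h1 h2
  have hfl : y / 2 ≤ ⌊y⌋₊ := by linarith [Nat.lt_floor_add_one y]
  refine ⟨Nat.le_floor hyN, hlog, ?_, ?_⟩
  · have hK := tailConst_pos
    have h3 : (⌊y⌋₊ : ℝ) ^ (-(1 / 10) : ℝ) ≤ 2 * y ^ (-(1 / 10) : ℝ) := by
      refine (Real.rpow_le_rpow_of_nonpos (by positivity) hfl (by norm_num)).trans ?_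
      rw [div_eq_mul_inv, Real.mul_rpow hy0.le (by norm_num), mul_comm,
        Real.inv_rpow (by norm_num), Real.rpow_neg (by norm_num), inv_inv]
      gcongr
      exact Real.rpow_le_self_of_one_le (by norm_num) (by norm_num)
    rw [le_div_iff₀ hl]
    calc _ ≤ tailConst * (2 * y ^ (-(1 / 10) : ℝ)) *
          (1 / (2 * tailConst) * y ^ (1 / 10 : ℝ)) := by gcongr
      _ = y ^ (-(1 / 10) : ℝ) * y ^ (1 / 10 : ℝ) := by field_simp
      _ = 1 := by
          rw [← Real.rpow_add hy0]
          norm_num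
  · have hll : Real.log (Real.log y) ≤ Real.log y := by
      linarith [Real.log_le_sub_one_of_pos hl]
    calc _ ≤ 19 * (1 / 38 * y ^ (1 / 6 : ℝ)) * y ^ (1 / 3 : ℝ) := by
          gcongr
          exact hll.trans h2
      _ = 1 / 2 * (y ^ (1 / 6 : ℝ) * y ^ (1 / 3 : ℝ)) := by ring
      _ = 1 / 2 * y ^ (1 / 2 : ℝ) := by
          rw [← Real.rpow_add hy0]
          norm_num
      _ ≤ (1 / 2 : ℝ) ^ (1 / 2 : ℝ) * y ^ (1 / 2 : ℝ) := by
          gcongr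
          exact Real.self_le_rpow_of_le_one (by norm_num) (by norm_num) (by norm_num)
      _ = (y / 2) ^ (1 / 2 : ℝ) := by
          rw [← Real.mul_rpow (by norm_num) hy0.le]
          ring_nf
      _ ≤ _ := by gcongr

/-- The exponent of the stated bound, with both `O(1)` terms equal to `0` and the `O(log ε)` term
equal to `-19 |log ε|`. -/
noncomputable def statedExponent (ε y : ℝ) : ℝ :=
  -(ε ^ 2 * y ^ (1 / 3 : ℝ)) / (Real.log y * (Real.log y + 0)) *
    (Real.log (Real.log y ^ 20 / (Real.log y + 0)) + -19 * |Real.log ε|)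

lemma statedExponent_eq {ε y : ℝ} (hl : 0 < Real.log y) :
    statedExponent ε y = -(ε ^ 2 * y ^ (1 / 3 : ℝ) / Real.log y ^ 2 *
      (19 * (Real.log (Real.log y) - |Real.log ε|))) := by
  have h1 : Real.log y ^ 20 / Real.log y = Real.log y ^ 19 := by
    field_simp
  rw [statedExponent, add_zero, h1, Real.log_pow]
  push_cast
  ring

/-- Outside the range `1 / log y ≤ ε ≤ log y` the stated bound is trivial. -/
lemma statedExponent_nonneg {ε y : ℝ} (hy : 0 ≤ y) (hl : 0 < Real.log y)
    (h : Real.log (Real.log y) ≤ |Real.log ε|) : 0 ≤ statedExponent ε y := by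
  rw [statedExponent_eq hl, neg_nonneg]
  exact mul_nonpos_of_nonneg_of_nonpos (by positivity) (by linarith)

/-- In the range `1 / log y ≤ ε ≤ log y` the stated exponent is at least
`-19 y^{1/3} log log y`. -/
lemma le_statedExponent {ε y : ℝ} (hε : 0 < ε) (hy : 0 ≤ y) (hl : 1 < Real.log y)
    (h : |Real.log ε| ≤ Real.log (Real.log y)) :
    -(19 * Real.log (Real.log y) * y ^ (1 / 3 : ℝ)) ≤ statedExponent ε y := by
  have hl0 : 0 < Real.log y := by linarith
  have hll : 0 ≤ Real.log (Real.log y) := Real.log_nonneg hl.le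
  have hεl : ε ≤ Real.log y := (Real.log_le_log_iff hε hl0).1 ((le_abs_self _).trans h)
  have h1 : ε ^ 2 * y ^ (1 / 3 : ℝ) / Real.log y ^ 2 ≤ y ^ (1 / 3 : ℝ) := by
    rw [div_le_iff₀ (by positivity), mul_comm]
    gcongr
  rw [statedExponent_eq hl0, neg_le_neg_iff]
  calc _ ≤ y ^ (1 / 3 : ℝ) * (19 * Real.log (Real.log y)) := by
        refine mul_le_mul h1 ?_ ?_ (by positivity)
        · linarith [abs_nonneg (Real.log ε)]
        · linarith
    _ = _ := by ring

lemma one_div_log_le {ε y : ℝ} (hε : 0 < ε) (hl : 0 < Real.log y)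
    (h : |Real.log ε| ≤ Real.log (Real.log y)) : 1 / Real.log y ≤ ε := by
  rw [← Real.log_le_log_iff (by positivity) hε, one_div, Real.log_inv]
  linarith [neg_abs_le (Real.log ε)]

end RoughPart

theorem mainTheorem3 :
    ∃ (C B y₀ : ℝ) (E₁ E₂ E₃ : ℝ → ℝ → ℝ),
      0 < C ∧ 0 < B ∧ 1 < y₀ ∧ B < Real.log y₀ ∧
      (∀ ε > 0, ∀ y ≥ y₀,
        |E₁ ε y| ≤ B ∧ |E₂ ε y| ≤ B ∧ |E₃ ε y| ≤ B * |Real.log ε|) ∧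
      ∀ {Ω : Type*} [MeasurableSpace Ω] (μ : Measure Ω) [IsProbabilityMeasure μ]
        (X : ℤ → Ω → ℂ), RoughPart.IsSteinhausRMF X μ →
        -- almost surely, the series defining the rough parts converge, uniformly on `[0,1]`
        (∀ᵐ ω ∂μ, ∀ y > 1, TendstoUniformlyOn
          (fun (z : ℝ) (t : ℝ) => RoughPart.truncatedRoughPart X y z ω t)
          (RoughPart.roughPart X y ω) atTop (Set.Icc 0 1)) ∧
        -- the bound for the probability of `‖R_y‖_∞ > ε`
        (∀ ε > 0, ∀ y ≥ y₀,
          μ (RoughPart.roughEvent X y ε) ≤ ENNReal.ofReal (C * Real.exp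
            (-(ε ^ 2 * y ^ (1 / 3 : ℝ)) / (Real.log y * (Real.log y + E₁ ε y)) *
              (Real.log (Real.log y ^ 20 / (Real.log y + E₂ ε y)) + E₃ ε y)))) ∧
        -- the same bound holds independently of `S_y`: conditionally on any event `A ∈ σ(S_y)`
        (∀ ε > 0, ∀ y ≥ y₀, ∀ A : Set Ω, MeasurableSet[RoughPart.smoothSigma X y] A →
          μ (RoughPart.roughEvent X y ε ∩ A) ≤ ENNReal.ofReal (C * Real.exp
            (-(ε ^ 2 * y ^ (1 / 3 : ℝ)) / (Real.log y * (Real.log y + E₁ ε y)) *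
              (Real.log (Real.log y ^ 20 / (Real.log y + E₂ ε y)) + E₃ ε y))) * μ A) ∧
        -- for each fixed `ε`, the probability tends to `0`
        (∀ ε > 0, Tendsto (fun y : ℝ => μ (RoughPart.roughEvent X y ε)) atTop (𝓝 0)) := by
  open RoughPart in
  obtain ⟨N₀, hN₀⟩ := exists_measure_roughEvent_le
  obtain ⟨y₁, hy₁⟩ := eventually_atTop.1 (eventually_rough_bounds N₀)
  set y₀ := max y₁ 2 with hy₀
  have hy₀log : 19 < Real.log y₀ := (hy₁ y₀ (le_max_left _ _)).2.1
  refine ⟨probConst, 19, y₀, fun _ _ => 0, fun _ _ => 0, fun ε _ => -19 * |Real.log ε|,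
    one_pos.trans_le one_le_probConst, by norm_num, one_lt_two.trans_le (le_max_right _ _), hy₀log,
    fun ε _ y _ => ⟨by simp, by simp, by simp [abs_mul]⟩, fun {Ω} _ μ _ X h => ?_⟩
  obtain ⟨hlim, hprob⟩ := hN₀ μ X h
  have hcond : ∀ ε > 0, ∀ y ≥ y₀, ∀ A : Set Ω, MeasurableSet[smoothSigma X y] A →
      μ (roughEvent X y ε ∩ A) ≤
        ENNReal.ofReal (probConst * Real.exp (statedExponent ε y)) * μ A := by
    intro ε hε y hy A hA
    have hy2 : 2 ≤ y := (le_max_right _ _).trans hy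
    obtain ⟨hyN, hlog, htail, hexp⟩ := hy₁ y ((le_max_left _ _).trans hy)
    have hl0 : 0 < Real.log y := by linarith
    rcases le_total |Real.log ε| (Real.log (Real.log y)) with hr | hr
    · refine (hprob y (by linarith) hyN ε (htail.trans (one_div_log_le hε hl0 hr)) A hA).trans ?_
      have := le_statedExponent hε (by linarith) (by linarith) hr
      have h1 := one_le_probConst
      gcongr
      linarith
    · have h1 := statedExponent_nonneg (by linarith : 0 ≤ y) hl0 hr
      have h2 : 1 ≤ probConst * Real.exp (statedExponent ε y) :=
        one_le_mul_of_one_le_of_one_le one_le_probConst (Real.one_le_exp h1)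
      calc μ (roughEvent X y ε ∩ A) ≤ 1 * μ A := by
            rw [one_mul]
            exact measure_mono Set.inter_subset_right
        _ ≤ _ := by
            gcongr
            rwa [ENNReal.one_le_ofReal]
  refine ⟨hlim, fun ε hε y hy => ?_, hcond, fun ε hε => ?_⟩
  · have := hcond ε hε y hy Set.univ MeasurableSet.univ
    rwa [Set.inter_univ, measure_univ, mul_one] at this
  · refine tendsto_of_tendsto_of_tendsto_of_le_of_le' tendsto_const_nhds
      (tendsto_probConst_mul_exp.comp tendsto_nat_floor_atTop)
      (Eventually.of_forall fun _ => bot_le) ?_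
    filter_upwards [eventually_ge_atTop y₀,
      (tendsto_inv_atTop_zero.comp Real.tendsto_log_atTop).eventually_le_const hε] with y hy hεy
    obtain ⟨hyN, hlog, htail, -⟩ := hy₁ y ((le_max_left _ _).trans hy)
    have hy2 : 2 ≤ y := (le_max_right _ _).trans hy
    have h1 : 1 / Real.log y ≤ ε := by rwa [one_div]
    have := hprob y (by linarith) hyN ε (htail.trans h1) Set.univ MeasurableSet.univ
    rwa [Set.inter_univ, measure_univ, mul_one] at this
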